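/- Let $\mathbb F$ be a field which is not the field with two elements, and let $n \ge 0$ be an integer. A (finite) $\partial$-graph is a finite undirected multigraph, self-loops allowed, whose vertex set $V$ is partitioned into interior vertices $V^\circ$ and boundary vertices $\partial V$. Write $E$ for its set of oriented edges, $e_-$ and $e_+$ for the starting and ending vertex of $e \in E$, and $\overline e$ for $e$ with the reverse orientation. A (finite) $\mathbb F$-network is a $\partial$-graph together with weights $w : E \to \mathbb F \setminus \{0\}$ with $w(\overline e) = w(e)$. For $u : V \to \mathbb F$ put $\Delta u(p) = \sum_{e :\, e_+ = p} w(e)\,(u(e_+) - u(e_-))$; $u$ is harmonic if $\Delta u(p) = 0$ for all $p \in V^\circ$. The boundary behavior of the network is the linear subspace $$\{(u|_{\partial V}, (\Delta u)|_{\partial V}) : u \text{ harmonic}\} \subset \mathbb F^{\partial V} \times \mathbb F^{\partial V}.$$ The electrical Grassmannian $EG_n(\mathbb F)$ is the set of all subspaces of $\mathbb F^n \times \mathbb F^n$ that are the boundary behavior of some finite $\mathbb F$-network with $\partial V = \{1,\dots,n\}$. A layer-stripping operation on a $\partial$-graph is one of the following: deleting some boundary edges (edges with both endpoints in $\partial V$);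 deleting some isolated boundary vertices (boundary vertices of degree $0$); or contracting some boundary spikes, no two of which share an endpoint. Here a boundary spike is an edge from a boundary vertex $p$ of degree $1$ to an interior vertex $q$; contracting it removes $p$ and the edge, and makes $q$ a boundary vertex. In each case zero deletions or contractions are allowed. A $\partial$-graph $G$ is layerable if there is a sequence of subgraphs $G = G_0 \supset G_1 \supset \cdots$, finite or infinite, with empty intersection, in which each $G_{j+1}$ is obtained from $G_j$ by a layer-stripping operation. A finite $\partial$-graph is circular planar if it can be embedded in the closed unit disk $\mathbb D \subset \mathbb C$ so that exactly the boundary vertices lie on the unit circle, the rest of the graph lies in the open disk, each edge is a smoothly immersed copy of $[0,1]$, and distinct oriented edges starting at the same vertex have starting velocities that are not positive multiples of each other. A network is layerable, respectively circular planar, if its $\partial$-graph is. Theorem. Every $\Lambda \in EG_n(\mathbb F)$ is the boundary behavior of a finite $\mathbb F$-network with $\partial V = \{1,\dots,n\}$ that is layerable and circular planar. -/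

import Mathlib

open scoped ContDiff

namespace Electrical

/-- A graph with boundary. The graph is an undirected multigraph, self-loops allowed; `E` is the
type of oriented edges, so each undirected edge is a pair `{e, rev e}` with `rev e ≠ e`.
The vertices outside `boundary` are the interior vertices. -/
structure BGraph (V E : Type) where
  /-- starting vertex of an oriented edge -/
  src : E → V
  /-- ending vertex of an oriented edge -/
  tgt : E → V
  /-- the same edge with the reverse orientation -/
  rev : E → E
  rev_rev : ∀ e, rev (rev e) = e
  rev_ne : ∀ e, rev e ≠ e
  src_rev : ∀ e, src (rev e) = tgt e
  tgt_rev : ∀ e, tgt (rev e) = src e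
  boundary : Set V

/-- A network: a graph with boundary, with nonzero weights on its (unoriented) edges. -/
structure Network (F : Type*) [Field F] (V E : Type) extends BGraph V E where
  weight : E → F
  weight_ne_zero : ∀ e, weight e ≠ 0
  weight_rev : ∀ e, weight (rev e) = weight e

namespace Network

variable {F : Type*} [Field F] {V E : Type}

open Classical in
/-- The weighted Laplacian: `Δ u (p)` is the sum of `w e * (u (e₊) - u (e₋))` over the oriented
edges `e` ending at `p`. -/
noncomputable def laplacian [Fintype E] (N : Network F V E) : (V → F) →ₗ[F] (V → F) where
  toFun u p := ∑ e : E with N.tgt e = p, N.weight e * (u (N.tgt e) - u (N.src e))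
  map_add' u v := by
    funext p
    simp only [Pi.add_apply, ← Finset.sum_add_distrib]
    exact Finset.sum_congr rfl fun e _ => by ring
  map_smul' c u := by
    funext p
    simp only [Pi.smul_apply, smul_eq_mul, RingHom.id_apply, Finset.mul_sum]
    exact Finset.sum_congr rfl fun e _ => by ring

/-- The space of harmonic functions: the Laplacian vanishes at all interior vertices. -/
noncomputable def harmonic [Fintype E] (N : Network F V E) : Submodule F (V → F) where
  carrier := {u | ∀ p, p ∉ N.boundary → N.laplacian u p = 0}
  add_mem' {u v} hu hv p hp := by simp [hu p hp, hv p hp]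
  zero_mem' p _ := by simp
  smul_mem' c u hu p hp := by simp [hu p hp]

/-- The linear map sending a potential `u` to `(u|_∂V, (Δ u)|_∂V)`. -/
noncomputable def boundaryData [Fintype E] (N : Network F V E) :
    (V → F) →ₗ[F] (N.boundary → F) × (N.boundary → F) :=
  (LinearMap.funLeft F F (Subtype.val : N.boundary → V)).prod
    ((LinearMap.funLeft F F (Subtype.val : N.boundary → V)).comp N.laplacian)

/-- The boundary behavior: the set of boundary data of harmonic functions. -/
noncomputable def boundaryBehavior [Fintype E] (N : Network F V E) :
    Submodule F ((N.boundary → F) × (N.boundary → F)) :=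
  N.harmonic.map N.boundaryData

/-- The boundary behavior as a subspace of `Fⁿ × Fⁿ`, when the boundary vertices are identified
with `{1, …, n}` through `lab`. -/
noncomputable def labelledBehavior [Fintype E] (N : Network F V E) {n : ℕ}
    (lab : Fin n ≃ N.boundary) : Submodule F ((Fin n → F) × (Fin n → F)) :=
  N.boundaryBehavior.map
    ((LinearMap.funLeft F F lab).prodMap (LinearMap.funLeft F F lab))

end Network

/-- The electrical Grassmannian: all boundary behaviors of finite networks over `F` whose
boundary is `{1, …, n}`. -/
def electricalGrassmannian (F : Type*) [Field F] (n : ℕ) :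
    Set (Submodule F ((Fin n → F) × (Fin n → F))) :=
  {Λ | ∃ (V E : Type) (_ : Fintype V) (_ : Fintype E) (N : Network F V E)
      (lab : Fin n ≃ N.boundary), N.labelledBehavior lab = Λ}

/-- A subgraph of a graph with boundary, with its own division of the vertices into interior
ones and boundary ones; interior vertices of the subgraph are interior in the big graph. -/
@[ext]
structure BSubgraph {V E : Type} (G : BGraph V E) where
  verts : Set V
  edges : Set E
  interior : Set V
  interior_subset : interior ⊆ verts
  interior_disjoint : ∀ p ∈ interior, p ∉ G.boundary
  rev_mem : ∀ e ∈ edges, G.rev e ∈ edges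
  src_mem : ∀ e ∈ edges, G.src e ∈ verts

namespace BSubgraph

variable {V E : Type} {G : BGraph V E}

/-- The whole graph, as a subgraph of itself. -/
def whole (G : BGraph V E) : BSubgraph G where
  verts := Set.univ
  edges := Set.univ
  interior := G.boundaryᶜ
  interior_subset := Set.subset_univ _
  interior_disjoint _ hp := hp
  rev_mem _ _ := Set.mem_univ _
  src_mem _ _ := Set.mem_univ _

/-- The boundary vertices of a subgraph. -/
def bdry (H : BSubgraph G) : Set V := H.verts \ H.interior

/-- The number of oriented edges of the subgraph that end at `p`. -/
noncomputable def degree (H : BSubgraph G) (p : V) : ℕ∞ :=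
  {e | e ∈ H.edges ∧ G.tgt e = p}.encard

/-- `H'` arises from `H` by deleting some (possibly no) boundary edges. -/
def BoundaryEdgeDeletion (H H' : BSubgraph G) : Prop :=
  H'.verts = H.verts ∧ H'.interior = H.interior ∧ H'.edges ⊆ H.edges ∧
    ∀ e ∈ H.edges \ H'.edges, G.src e ∈ H.bdry ∧ G.tgt e ∈ H.bdry

/-- `H'` arises from `H` by deleting some (possibly no) isolated boundary vertices. -/
def IsolatedVertexDeletion (H H' : BSubgraph G) : Prop :=
  H'.edges = H.edges ∧ H'.interior = H.interior ∧ H'.verts ⊆ H.verts ∧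
    ∀ p ∈ H.verts \ H'.verts, p ∈ H.bdry ∧ H.degree p = 0

/-- The oriented edge `e`, pointing from a boundary vertex of degree one to an interior vertex,
is a boundary spike. -/
def IsBoundarySpike (H : BSubgraph G) (e : E) : Prop :=
  e ∈ H.edges ∧ G.src e ∈ H.bdry ∧ H.degree (G.src e) = 1 ∧ G.tgt e ∈ H.interior

/-- `H'` arises from `H` by contracting a (possibly empty) set `S` of boundary spikes, no two of
which share an endpoint. The contracted spike is identified with its formerly interior endpoint,
which becomes a boundary vertex. -/
def BoundarySpikeContraction (H H' : BSubgraph G) : Prop :=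
  ∃ S : Set E, (∀ e ∈ S, H.IsBoundarySpike e) ∧
    (∀ e ∈ S, ∀ e' ∈ S, e ≠ e' → G.src e ≠ G.src e' ∧ G.tgt e ≠ G.tgt e') ∧
    H'.edges = H.edges \ (S ∪ G.rev '' S) ∧
    H'.verts = H.verts \ G.src '' S ∧
    H'.interior = H.interior \ G.tgt '' S

/-- A layer-stripping operation. -/
def LayerStripping (H H' : BSubgraph G) : Prop :=
  BoundaryEdgeDeletion H H' ∨ IsolatedVertexDeletion H H' ∨ BoundarySpikeContraction H H'

end BSubgraph

namespace BGraph

variable {V E : Type}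

/-- `G` is layerable: there is a filtration `G = H 0 ⊇ H 1 ⊇ …` with empty intersection, each
term of which arises from the one before by a layer-stripping operation. As trivial operations
are allowed, filtrations of finite length are covered. (If no vertex is in the intersection
then no edge is.) -/
def Layerable (G : BGraph V E) : Prop :=
  ∃ H : ℕ → BSubgraph G, H 0 = BSubgraph.whole G ∧
    (∀ j, BSubgraph.LayerStripping (H j) (H (j + 1))) ∧ ⋂ j, (H j).verts = ∅

/-- A smooth embedding of a finite graph with boundary in the closed unit disk of `ℂ`: the vertex
`v` is placed at `pt v` and the oriented edge `e` is the curve `curve e` on `[0, 1]`. -/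
structure DiskEmbedding (G : BGraph V E) where
  pt : V → ℂ
  curve : E → ℝ → ℂ
  /-- The data glue to a map on the topological space of the graph. -/
  curve_zero : ∀ e, curve e 0 = pt (G.src e)
  curve_one : ∀ e, curve e 1 = pt (G.tgt e)
  curve_rev : ∀ e, ∀ t ∈ Set.Icc (0 : ℝ) 1, curve (G.rev e) t = curve e (1 - t)
  /-- That map takes values in the closed disk and meets the unit circle exactly in the
  boundary vertices. -/
  norm_pt_le : ∀ v, ‖pt v‖ ≤ 1
  norm_pt_eq_one_iff : ∀ v, ‖pt v‖ = 1 ↔ v ∈ G.boundary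
  norm_curve_lt : ∀ e, ∀ t ∈ Set.Ioo (0 : ℝ) 1, ‖curve e t‖ < 1
  /-- That map is injective. -/
  pt_injective : Function.Injective pt
  curve_ne_pt : ∀ e, ∀ t ∈ Set.Ioo (0 : ℝ) 1, ∀ v, curve e t ≠ pt v
  curve_injective : ∀ e e', ∀ s ∈ Set.Ioo (0 : ℝ) 1, ∀ t ∈ Set.Ioo (0 : ℝ) 1,
    curve e s = curve e' t → (e' = e ∧ t = s) ∨ (e' = G.rev e ∧ t = 1 - s)
  /-- Each edge is a smooth immersion of `[0, 1]`. -/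
  smooth : ∀ e, ContDiffOn ℝ ∞ (curve e) (Set.Icc 0 1)
  immersion : ∀ e, ∀ t ∈ Set.Icc (0 : ℝ) 1, derivWithin (curve e) (Set.Icc 0 1) t ≠ 0
  /-- Distinct oriented edges exit a vertex in different directions. -/
  directions : ∀ e e', e ≠ e' → G.src e = G.src e' → ∀ c : ℝ, 0 < c →
    derivWithin (curve e') (Set.Icc 0 1) 0 ≠ c • derivWithin (curve e) (Set.Icc 0 1) 0

/-- `G` is circular planar. -/
def CircularPlanar (G : BGraph V E) : Prop := Nonempty (DiskEmbedding G)

end BGraph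

end Electrical

/-!
The boundary behavior `Λ` of a network is a Lagrangian subspace of `Fⁿ × Fⁿ` for the standard
symplectic form, by Green's identity and Fredholm duality, and it contains the constant potential
`(1, 0)` (`Network.isLagrangian_labelledBehavior`, `Network.const_mem_labelledBehavior`).
Conversely every Lagrangian subspace that contains `(1, 0)` is the behavior of a grid, with
boundary the top row, all vertical edges, and some of the horizontal edges below the top row.

Grids are layerable, by contracting the vertical edges at the top and deleting the horizontal edges
that come to light, in turn (`layerable_gridGraph`), and circular planar, by drawing them in polar
coordinates (`circularPlanar_gridGraph`). A harmonic function on a grid is determined by its values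
in the bottom row, from where it propagates upwards by symplectic maps `attachEdges c`, which add
edges between neighboring boundary vertices, and `attachSpikes r`, which add boundary spikes. So
the behavior of a grid is the image of `Fⁿ × 0` under a product of such maps
(`labelledBehavior_gridNetwork`).

It remains to move an arbitrary Lagrangian `Λ` containing `(1, 0)` to `Fⁿ × 0` by these maps
(`attainable_of_isolated`). Suppose that the vertices after `m` are isolated, that is `(e_j, 0) ∈ Λ`
for `j > m`. If `(e_m, 0) ∉ Λ` then some `v ∈ Λ` has nonzero current at `m`. In the coordinates
`chainCoord` of `v`, in which potential differences alternate with partial sums of currents, the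
moves among the first `m + 1` vertices change any single entry arbitrarily if its two neighbors
differ. By an elementary argument on sequences (`good_of_exists_ne_zero`) they take `v` to
a vector whose only nonzero entry is the potential difference between the vertices `m` and `0`.
Then the new `Λ` contains `(e_m, 0)`, and `m` decreases.

A third element of `F` is used twice: in the argument on sequences, and to write every resistance,
zero included, as a sum of two nonzero ones, so that spikes that are not wanted can be cancelled.
-/

namespace Electrical

/-! ### Boundary behaviors are Lagrangian -/

/-- The standard symplectic form on `Fⁿ × Fⁿ`. -/
def symplectic {F ι : Type*} [Field F] [Fintype ι] (v w : (ι → F) × (ι → F)) : F :=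
  v.1 ⬝ᵥ w.2 - v.2 ⬝ᵥ w.1

/-- A Lagrangian subspace, encoded as a subspace equal to its own symplectic complement. -/
def IsLagrangian {F ι : Type*} [Field F] [Fintype ι]
    (Λ : Submodule F ((ι → F) × (ι → F))) : Prop :=
  ∀ v, v ∈ Λ ↔ ∀ w ∈ Λ, symplectic v w = 0

namespace Network

variable {F : Type*} [Field F] {V E : Type}

lemma laplacian_apply [Fintype E] [DecidableEq V] (N : Network F V E) (u : V → F) (p : V) :
    N.laplacian u p =
      ∑ e, if N.tgt e = p then N.weight e * (u (N.tgt e) - u (N.src e)) else 0 := by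
  classical
  rw [← Finset.sum_filter]
  simp only [laplacian, LinearMap.coe_mk, AddHom.coe_mk]
  congr!

/-- The reversal of oriented edges, as a permutation. -/
def revPerm (N : Network F V E) : Equiv.Perm E := ⟨N.rev, N.rev, N.rev_rev, N.rev_rev⟩

lemma dotProduct_laplacian [Fintype V] [Fintype E] (N : Network F V E) (u v : V → F) :
    u ⬝ᵥ N.laplacian v = ∑ e, N.weight e * (u (N.tgt e) * v (N.tgt e)) -
      ∑ e, N.weight e * (u (N.tgt e) * v (N.src e)) := by
  classical
  simp only [dotProduct, laplacian_apply, Finset.mul_sum]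
  rw [Finset.sum_comm, ← Finset.sum_sub_distrib]
  refine Finset.sum_congr rfl fun e _ => ?_
  simp only [mul_ite, mul_zero, Finset.sum_ite_eq, Finset.mem_univ, if_true]
  ring

/-- Green's identity: the weighted Laplacian is symmetric. -/
lemma dotProduct_laplacian_comm [Fintype V] [Fintype E] (N : Network F V E) (u v : V → F) :
    u ⬝ᵥ N.laplacian v = v ⬝ᵥ N.laplacian u := by
  rw [dotProduct_laplacian, dotProduct_laplacian]
  congr 1
  · exact Finset.sum_congr rfl fun e _ => by ring
  · rw [← Equiv.sum_comp N.revPerm]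
    refine Finset.sum_congr rfl fun e _ => ?_
    simp only [revPerm, Equiv.coe_fn_mk, N.weight_rev, N.tgt_rev, N.src_rev]
    ring

variable {n : ℕ}

lemma mem_labelledBehavior [Fintype E] (N : Network F V E) (lab : Fin n ≃ N.boundary)
    (v : (Fin n → F) × (Fin n → F)) :
    v ∈ N.labelledBehavior lab ↔ ∃ u, (∀ p, p ∉ N.boundary → N.laplacian u p = 0) ∧
      (fun i => u (lab i)) = v.1 ∧ (fun i => N.laplacian u (lab i)) = v.2 := by
  simp only [labelledBehavior, boundaryBehavior, Submodule.mem_map]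
  constructor
  · rintro ⟨_, ⟨u, hu, rfl⟩, rfl⟩
    exact ⟨u, hu, rfl, rfl⟩
  · rintro ⟨u, hu, h1, h2⟩
    exact ⟨_, ⟨u, hu, rfl⟩, Prod.ext h1 h2⟩

lemma sum_labelled [Fintype V] (N : Network F V E) (lab : Fin n ≃ N.boundary) (f : V → F)
    (hf : ∀ p, p ∉ N.boundary → f p = 0) : ∑ i, f (lab i) = ∑ p, f p := by
  refine Fintype.sum_of_injective (fun i => (lab i : V))
    (Subtype.val_injective.comp lab.injective) _ _ (fun p hp => hf p fun h => ?_) fun _ => rfl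
  exact hp ⟨lab.symm ⟨p, h⟩, by simp⟩

/-- The boundary behavior is isotropic by Green's identity. It is its own complement because
`{(x, y) | the boundary value problem with data (x, y) is solvable}` is cut out by the functionals
vanishing on the range of a linear map, and such functionals come from harmonic functions. -/
theorem isLagrangian_labelledBehavior [Fintype V] [Fintype E] (N : Network F V E)
    (lab : Fin n ≃ N.boundary) : IsLagrangian (N.labelledBehavior lab) := by
  classical
  have green : ∀ u v : V → F, (∀ p, p ∉ N.boundary → N.laplacian v p = 0) →
      (fun i => u (lab i)) ⬝ᵥ (fun i => N.laplacian v (lab i)) = u ⬝ᵥ N.laplacian v := by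
    intro u v hv
    exact N.sum_labelled lab (fun p => u p * N.laplacian v p) fun p hp => by simp [hv p hp]
  intro v
  constructor
  · rintro hv w hw
    obtain ⟨a, ha, ha1, ha2⟩ := (N.mem_labelledBehavior lab v).1 hv
    obtain ⟨b, hb, hb1, hb2⟩ := (N.mem_labelledBehavior lab w).1 hw
    rw [symplectic, ← ha1, ← ha2, ← hb1, ← hb2, green _ _ hb,
      dotProduct_comm (fun i => N.laplacian a (lab i)), green _ _ ha, dotProduct_laplacian_comm,
      sub_self]
  · intro hv
    obtain ⟨x, y⟩ := v
    let A : (V → F) →ₗ[F] (Fin n → F) × (V → F) :=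
      (LinearMap.funLeft F F fun i => (lab i : V)).prod N.laplacian
    let y' : V → F := fun p => if h : p ∈ N.boundary then y (lab.symm ⟨p, h⟩) else 0
    have hy' : ∀ i, y' (lab i) = y i := by intro i; simp [y']
    by_cases hmem : (x, y') ∈ LinearMap.range A
    · obtain ⟨u, hu⟩ := hmem
      have h1 : (fun i => u (lab i)) = x := congrArg Prod.fst hu
      have h2 : N.laplacian u = y' := congrArg Prod.snd hu
      refine (N.mem_labelledBehavior lab _).2 ⟨u, fun p hp => ?_, h1, ?_⟩
      · rw [h2]; simp [y', hp]
      · funext i; rw [h2]; exact hy' i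
    · exfalso
      obtain ⟨f, hf, hle⟩ := Submodule.exists_le_ker_of_notMem hmem
      let a : Fin n → F := fun i => f (Pi.single i 1, 0)
      let b : V → F := fun p => f (0, Pi.single p 1)
      have hfab : ∀ s z, f (s, z) = a ⬝ᵥ s + b ⬝ᵥ z := by
        intro s z
        have e1 : (s, z) = ∑ i, s i • ((Pi.single i 1 : Fin n → F), (0 : V → F)) +
            ∑ p, z p • ((0 : Fin n → F), (Pi.single p 1 : V → F)) := by
          ext q
          · simp [Prod.fst_sum, Finset.sum_apply, Pi.single_apply]
          · simp [Prod.snd_sum, Finset.sum_apply, Pi.single_apply]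
        rw [e1, map_add, map_sum, map_sum]
        simp only [map_smul, smul_eq_mul, dotProduct, a, b, mul_comm]
      have hb : ∀ p, N.laplacian b p = - ∑ i, if (lab i : V) = p then a i else 0 := by
        intro p
        have h0 : f (A (Pi.single p 1)) = 0 := hle ⟨_, rfl⟩
        have h1 : f (A (Pi.single p 1)) =
            a ⬝ᵥ (fun i => (Pi.single p 1 : V → F) (lab i)) + b ⬝ᵥ N.laplacian (Pi.single p 1) :=
          hfab _ _
        rw [h0, dotProduct_laplacian_comm, single_dotProduct, one_mul] at h1
        rw [eq_neg_iff_add_eq_zero, add_comm]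
        simpa [dotProduct, Pi.single_apply] using h1.symm
      have hbi : ∀ p, p ∉ N.boundary → N.laplacian b p = 0 := by
        intro p hp
        rw [hb, neg_eq_zero]
        refine Finset.sum_eq_zero fun i _ => if_neg ?_
        rintro rfl
        exact hp (lab i).2
      have hbb : ∀ i, N.laplacian b (lab i) = - a i := by
        intro i
        simp [hb, Subtype.val_inj]
      have hω := hv _ ((N.mem_labelledBehavior lab
        (fun i => b (lab i), fun i => N.laplacian b (lab i))).2 ⟨b, hbi, rfl, rfl⟩)
      apply hf
      have e2 : b ⬝ᵥ y' = ∑ i, b (lab i) * y i := by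
        rw [dotProduct, ← N.sum_labelled lab (fun p => b p * y' p)]
        · simp only [hy']
        · intro p hp; simp [y', hp]
      rw [hfab, e2]
      simp only [symplectic, hbb, dotProduct, mul_neg, Finset.sum_neg_distrib] at hω ⊢
      rw [← neg_eq_zero, ← hω]
      simp only [mul_comm]
      ring

lemma const_mem_labelledBehavior [Fintype E] (N : Network F V E) (lab : Fin n ≃ N.boundary) :
    ((fun _ => 1, 0) : (Fin n → F) × (Fin n → F)) ∈ N.labelledBehavior lab := by
  classical
  have h : ∀ p, N.laplacian (fun _ => 1) p = 0 := fun p => by simp [laplacian_apply]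
  exact (N.mem_labelledBehavior lab _).2 ⟨fun _ => 1, fun p _ => h p, rfl, funext fun i => h _⟩

end Network

/-! ### Changing entries of a sequence whose neighbors differ -/

section Sequences

variable {F : Type*} [Field F] {m : ℕ} {good : (ℕ → F) → Prop}

/-- If the entries of `p` before `2 m - d` are `0` and those from there to `2 m` are not, then the
entries from `2 m - d` to `2 m - 1` can be made `0` in this order, as `p j` may be changed while
`p (j - 1) = 0 ≠ p (j + 1)`. -/
lemma good_of_forall_ne_zero
    (base : ∀ p, (∀ j < 2 * m, p j = 0) → p (2 * m) ≠ 0 → p (2 * m + 1) = 0 → good p)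
    (step : ∀ p j a, 1 ≤ j → j ≤ 2 * m → p (j - 1) ≠ p (j + 1) →
      good (Function.update p j a) → good p) (d : ℕ) :
    ∀ p : ℕ → F, d < 2 * m → (∀ j < 2 * m - d, p j = 0) →
      (∀ j, 2 * m - d ≤ j → j ≤ 2 * m → p j ≠ 0) → p (2 * m + 1) = 0 → good p := by
  induction d with
  | zero => exact fun p _ h0 h1 h2 => base p h0 (h1 _ le_rfl le_rfl) h2
  | succ d ih =>
    intro p hd h0 h1 h2
    refine step p (2 * m - (d + 1)) 0 (by omega) (by omega) ?_ (ih _ (by omega) ?_ ?_ ?_)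
    · rw [h0 _ (by omega)]
      exact (h1 _ (by omega) (by omega)).symm
    · intro j hj
      by_cases h : j = 2 * m - (d + 1)
      · simp [h]
      · rw [Function.update_of_ne h]; exact h0 _ (by omega)
    · intro j hj hj'
      rw [Function.update_of_ne (by omega)]; exact h1 _ (by omega) hj'
    · rw [Function.update_of_ne (by omega)]; exact h2

/-- If the zeros of `p` come with zeros at distance two, and every zero has equal neighbors, then
`p` vanishes: parity forces zeros at both ends, which spread. -/
lemma eq_zero_of_zeros_spread (p : ℕ → F) (p0 : p 0 = 0) (pN : p (2 * m + 1) = 0)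
    (hnb : ∀ j, 1 ≤ j → j ≤ 2 * m → p j = 0 → p (j - 1) = p (j + 1))
    (hup : ∀ j, 1 ≤ j → j < 2 * m → p j = 0 → p (j + 2) = 0)
    (hdown : ∀ j, 2 ≤ j → j ≤ 2 * m → p j = 0 → p (j - 2) = 0)
    (hz : ∃ j, 1 ≤ j ∧ j ≤ 2 * m ∧ p j = 0) : ∀ j ≤ 2 * m + 1, p j = 0 := by
  have down : ∀ k, 2 * k + 1 ≤ 2 * m → p (2 * k + 1) = 0 → p 1 = 0 := by
    intro k
    induction k with
    | zero => exact fun _ h => h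
    | succ k ih => exact fun h h' => ih (by omega) (hdown (2 * (k + 1) + 1) (by omega) h h')
  have up : ∀ d j, 1 ≤ j → j + 2 * d ≤ 2 * m → p j = 0 → p (j + 2 * d) = 0 := by
    intro d
    induction d with
    | zero => exact fun j _ _ h => h
    | succ d ih =>
      exact fun j hj h h' => hup (j + 2 * d) (by omega) (by omega) (ih j hj (by omega) h')
  obtain ⟨j, hj1, hj2, hj⟩ := hz
  have p1 : p 1 = 0 := by
    rcases Nat.even_or_odd' j with ⟨k, rfl | rfl⟩
    · have h := up (m - k) (2 * k) hj1 (by omega) hj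
      rw [show 2 * k + 2 * (m - k) = 2 * m by omega] at h
      have h' := hnb (2 * m) (by omega) le_rfl h
      rw [pN] at h'
      refine down (m - 1) (by omega) ?_
      rwa [show 2 * (m - 1) + 1 = 2 * m - 1 by omega]
    · exact down k hj2 hj
  have p2 : p 2 = 0 := by
    have := hnb 1 le_rfl (by omega) p1
    simpa [p0] using this.symm
  intro i hi
  by_cases hi0 : i = 0
  · rw [hi0, p0]
  by_cases hiN : i = 2 * m + 1
  · rw [hiN, pN]
  rcases Nat.even_or_odd' i with ⟨k, rfl | rfl⟩
  · have := up (k - 1) 2 (by omega) (by omega) p2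
    rwa [show 2 + 2 * (k - 1) = 2 * k by omega] at this
  · have := up k 1 (by omega) (by omega) p1
    rwa [show 1 + 2 * k = 2 * k + 1 by omega] at this

/-- A move changes an entry `p j` with `1 ≤ j ≤ 2m` whose two neighbors differ, to any value. If
`good` is inherited by `p` from the results of moves, and holds for all sequences whose only nonzero
entry is `p (2m)`, then it holds for every `p` with `p 0 = p (2m + 1) = 0` that has a nonzero entry
in between. For such `p`, the number of zeros can be decreased until none is left; this is where a
third element of the field is needed. -/
theorem good_of_exists_ne_zero (hF : ∀ a : F, ∃ s, s ≠ 0 ∧ s ≠ a)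
    (base : ∀ p, (∀ j < 2 * m, p j = 0) → p (2 * m) ≠ 0 → p (2 * m + 1) = 0 → good p)
    (step : ∀ p j a, 1 ≤ j → j ≤ 2 * m → p (j - 1) ≠ p (j + 1) →
      good (Function.update p j a) → good p)
    (p : ℕ → F) (p0 : p 0 = 0) (pN : p (2 * m + 1) = 0)
    (hp : ∃ j ≤ 2 * m, p j ≠ 0) : good p := by
  classical
  induction hz : ((Finset.Icc 1 (2 * m)).filter (p · = 0)).card using Nat.strong_induction_on
    generalizing p with
  | _ z ih =>
  subst hz
  by_cases hne : ∃ j, 1 ≤ j ∧ j ≤ 2 * m ∧ p j = 0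
  swap
  · push Not at hne
    obtain ⟨j, hj, hj'⟩ := hp
    have : 0 < j := Nat.pos_of_ne_zero (by rintro rfl; exact hj' p0)
    refine good_of_forall_ne_zero base step (2 * m - 1) p (by omega) ?_ ?_ pN
    · intro i hi
      rwa [show i = 0 by omega]
    · exact fun i hi hi' => hne i (by omega) hi'
  -- filling in a zero at `j` yields a sequence with fewer zeros
  have fill : ∀ q : ℕ → F, (∀ i, q i = 0 ↔ p i = 0) → ∀ j, 1 ≤ j → j ≤ 2 * m → p j = 0 →
      q (j - 1) ≠ q (j + 1) → good q := by
    intro q hq j hj1 hj2 hj hqj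
    have hupd : ∀ i, i ≠ j → Function.update q j 1 i = q i :=
      fun i hi => Function.update_of_ne hi _ _
    refine step q j 1 hj1 hj2 hqj (ih _ (Finset.card_lt_card ?_) _ ?_ ?_ ?_ rfl)
    · refine (Finset.ssubset_iff_of_subset ?_).2 ⟨j, ?_, ?_⟩
      · intro i hi
        simp only [Finset.mem_filter] at hi ⊢
        refine ⟨hi.1, ?_⟩
        by_cases h : i = j
        · rw [h, hj]
        · rw [← hq, ← hupd i h]; exact hi.2
      · simp [hj, hj1, hj2]
      · simp
    · rw [hupd _ (by omega), hq, p0]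
    · rw [hupd _ (by omega), hq, pN]
    · exact ⟨j, hj2, by simp⟩
  by_cases hA : ∃ j, 1 ≤ j ∧ j ≤ 2 * m ∧ p j = 0 ∧ p (j - 1) ≠ p (j + 1)
  · obtain ⟨j, h1, h2, h3, h4⟩ := hA
    exact fill p (fun _ => Iff.rfl) j h1 h2 h3 h4
  push Not at hA
  -- a zero with equal neighbors can be filled in if one of the neighbors can be changed first
  have adjust : ∀ i j, 1 ≤ i → i ≤ 2 * m → p i ≠ 0 → p (i - 1) ≠ p (i + 1) →
      1 ≤ j → j ≤ 2 * m → p j = 0 → (i = j - 1 ∨ i = j + 1) → good p := by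
    intro i j hi1 hi2 hi hi' hj1 hj2 hj hij
    obtain ⟨s, hs0, hs⟩ := hF (p i)
    have hnb := hA j hj1 hj2 hj
    refine step p i s hi1 hi2 hi' (fill _ ?_ j hj1 hj2 hj ?_)
    · intro k
      by_cases h : k = i
      · simp [h, hs0, hi]
      · rw [Function.update_of_ne h]
    · rcases hij with rfl | rfl
      · rw [Function.update_self, Function.update_of_ne (by omega), ← hnb]
        exact hs
      · rw [Function.update_self, Function.update_of_ne (by omega), hnb]
        exact hs.symm
  by_contra hgood
  obtain ⟨j, hj, hj'⟩ := hp
  refine hj' (eq_zero_of_zeros_spread p p0 pN hA ?_ ?_ hne j (by omega))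
  · intro j hj1 hj2 hj
    by_cases h : p (j + 1) = 0
    · have := hA (j + 1) (by omega) (by omega) h
      rw [← this]; exact hj
    · by_contra h'
      refine hgood (adjust (j + 1) j (by omega) (by omega) h ?_ hj1 (by omega) hj (Or.inr rfl))
      rw [show j + 1 - 1 = j by omega, hj]
      exact fun h'' => h' h''.symm
  · intro j hj1 hj2 hj
    by_cases h : p (j - 1) = 0
    · have := hA (j - 1) (by omega) (by omega) h
      rw [show j - 1 - 1 = j - 2 by omega, show j - 1 + 1 = j by omega] at this
      rw [this, hj]
    · by_contra h'
      refine hgood (adjust (j - 1) j (by omega) (by omega) h ?_ (by omega) (by omega) hj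
        (Or.inl rfl))
      rw [show j - 1 - 1 = j - 2 by omega, show j - 1 + 1 = j by omega, hj]
      exact h'

end Sequences

/-! ### Grid networks and their boundary behavior -/

section Moves

variable {F : Type*} [Field F] {n : ℕ}

/-- The left of the two columns `k` and `k + 1`. -/
def leftCol (k : Fin (n - 1)) : Fin n := ⟨k, by omega⟩

/-- The right of the two columns `k` and `k + 1`. -/
def rightCol (k : Fin (n - 1)) : Fin n := ⟨k + 1, by omega⟩

/-- The Laplacian of the path `0 — 1 — ⋯ — (n - 1)` whose edge `k — (k + 1)` has weight `c k`;
weight `0` means that the edge is absent. -/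
def pathLaplacian (c : Fin (n - 1) → F) : (Fin n → F) →ₗ[F] (Fin n → F) where
  toFun x := ∑ k, (c k * (x (leftCol k) - x (rightCol k))) •
    (Pi.single (leftCol k) 1 - Pi.single (rightCol k) 1)
  map_add' x y := by
    rw [← Finset.sum_add_distrib]
    refine Finset.sum_congr rfl fun k _ => ?_
    rw [← add_smul]
    congr 1
    simp only [Pi.add_apply]
    ring
  map_smul' a x := by
    rw [Finset.smul_sum]
    refine Finset.sum_congr rfl fun k _ => ?_
    rw [smul_smul]
    congr 1
    simp only [Pi.smul_apply, smul_eq_mul, RingHom.id_apply]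
    ring

lemma pathLaplacian_def (c : Fin (n - 1) → F) (x : Fin n → F) :
    pathLaplacian c x = ∑ k, (c k * (x (leftCol k) - x (rightCol k))) •
      (Pi.single (leftCol k) 1 - Pi.single (rightCol k) 1) := rfl

lemma pathLaplacian_apply (c : Fin (n - 1) → F) (x : Fin n → F) (i : Fin n) :
    pathLaplacian c x i = ∑ k,
      ((if leftCol k = i then c k * (x (leftCol k) - x (rightCol k)) else 0) +
        if rightCol k = i then c k * (x (rightCol k) - x (leftCol k)) else 0) := by
  rw [pathLaplacian_def, Finset.sum_apply]
  refine Finset.sum_congr rfl fun k _ => ?_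
  simp only [Pi.smul_apply, Pi.sub_apply, Pi.single_apply, smul_eq_mul, eq_comm (a := i)]
  split_ifs <;> ring

lemma pathLaplacian_neg (c : Fin (n - 1) → F) (x : Fin n → F) :
    pathLaplacian (-c) x = - pathLaplacian c x := by
  simp [pathLaplacian_def, neg_smul, Finset.sum_neg_distrib]

lemma pathLaplacian_zero (x : Fin n → F) :
    pathLaplacian (0 : Fin (n - 1) → F) x = 0 := by
  simp [pathLaplacian_def]

lemma dotProduct_pathLaplacian (c : Fin (n - 1) → F) (x y : Fin n → F) :
    y ⬝ᵥ pathLaplacian c x = ∑ k, c k * (x (leftCol k) - x (rightCol k)) *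
      (y (leftCol k) - y (rightCol k)) := by
  rw [pathLaplacian_def, dotProduct_sum]
  refine Finset.sum_congr rfl fun k _ => ?_
  simp [dotProduct_smul, dotProduct_sub]

/-- The effect on boundary data of attaching a boundary spike of resistance `r i` to each boundary
vertex `i`; resistance `0` means that no spike is attached. -/
def attachSpikes (r : Fin n → F) :
    ((Fin n → F) × (Fin n → F)) →ₗ[F] ((Fin n → F) × (Fin n → F)) where
  toFun v := (v.1 + r * v.2, v.2)
  map_add' v w := by ext i <;> simp; ring
  map_smul' a v := by ext i <;> simp

/-- The effect on boundary data of attaching boundary edges of weights `c k` between boundary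
vertices `k` and `k + 1`; weight `0` means that no edge is attached. -/
def attachEdges (c : Fin (n - 1) → F) :
    ((Fin n → F) × (Fin n → F)) →ₗ[F] ((Fin n → F) × (Fin n → F)) where
  toFun v := (v.1, v.2 + pathLaplacian c v.1)
  map_add' v w := by ext i <;> simp; ring
  map_smul' a v := by ext i <;> simp

lemma attachSpikes_apply (r : Fin n → F) (v : (Fin n → F) × (Fin n → F)) :
    attachSpikes r v = (v.1 + r * v.2, v.2) := rfl

lemma attachEdges_apply (c : Fin (n - 1) → F) (v : (Fin n → F) × (Fin n → F)) :
    attachEdges c v = (v.1, v.2 + pathLaplacian c v.1) := rfl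

lemma attachSpikes_comp (r s : Fin n → F) :
    attachSpikes r ∘ₗ attachSpikes s = attachSpikes (r + s) := by
  refine LinearMap.ext fun v => ?_
  ext i <;> simp [attachSpikes_apply]; ring

lemma attachSpikes_zero : attachSpikes (0 : Fin n → F) = LinearMap.id :=
  LinearMap.ext fun v => by simp [attachSpikes_apply]

lemma attachEdges_zero : attachEdges (0 : Fin (n - 1) → F) = LinearMap.id :=
  LinearMap.ext fun v => by simp [attachEdges_apply, pathLaplacian_zero]

lemma attachEdges_neg_comp (c : Fin (n - 1) → F) :
    attachEdges (-c) ∘ₗ attachEdges c = LinearMap.id :=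
  LinearMap.ext fun v => by simp [attachEdges_apply, pathLaplacian_neg]

lemma attachSpikes_neg_comp (r : Fin n → F) :
    attachSpikes (-r) ∘ₗ attachSpikes r = LinearMap.id := by
  rw [attachSpikes_comp, neg_add_cancel, attachSpikes_zero]

lemma symplectic_attachSpikes (r : Fin n → F) (v w : (Fin n → F) × (Fin n → F)) :
    symplectic (attachSpikes r v) (attachSpikes r w) = symplectic v w := by
  simp only [symplectic, attachSpikes_apply, dotProduct, ← Finset.sum_sub_distrib, Pi.add_apply,
    Pi.mul_apply]
  exact Finset.sum_congr rfl fun i _ => by ring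

lemma symplectic_attachEdges (c : Fin (n - 1) → F) (v w : (Fin n → F) × (Fin n → F)) :
    symplectic (attachEdges c v) (attachEdges c w) = symplectic v w := by
  have h : v.1 ⬝ᵥ pathLaplacian c w.1 = w.1 ⬝ᵥ pathLaplacian c v.1 := by
    rw [dotProduct_pathLaplacian, dotProduct_pathLaplacian]
    exact Finset.sum_congr rfl fun k _ => by ring
  simp only [symplectic, attachEdges_apply, dotProduct_add, add_dotProduct, h,
    dotProduct_comm (pathLaplacian c v.1)]
  ring

/-- The effect on boundary data of `t` layers, each of which consists of edges between adjacent
columns, of weights `c s`, and of spikes on all columns, of resistances `ρ s`. -/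
def flow (ρ : ℕ → Fin n → F) (c : ℕ → Fin (n - 1) → F) :
    ℕ → ((Fin n → F) × (Fin n → F)) →ₗ[F] ((Fin n → F) × (Fin n → F))
  | 0 => LinearMap.id
  | t + 1 => attachSpikes (ρ t) ∘ₗ attachEdges (c t) ∘ₗ flow ρ c t

lemma flow_congr {ρ ρ' : ℕ → Fin n → F} {c c' : ℕ → Fin (n - 1) → F} (t : ℕ)
    (hρ : ∀ s < t, ρ s = ρ' s) (hc : ∀ s < t, c s = c' s) : flow ρ c t = flow ρ' c' t := by
  induction t with
  | zero => rfl
  | succ t ih =>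
    rw [flow, flow, hρ t (by omega), hc t (by omega),
      ih (fun s hs => hρ s (by omega)) fun s hs => hc s (by omega)]

end Moves

section Grid

/-- The unoriented edges of a grid with columns `0, …, n - 1` and rows `0, …, T`: vertical edges
`(i, t)` joining the rows `t` and `t + 1` in column `i`, and the horizontal edges `(k, t) ∈ S`
joining the columns `k` and `k + 1` in row `t`. -/
abbrev GridLine (n T : ℕ) (S : Set (Fin (n - 1) × Fin T)) : Type := (Fin n × Fin T) ⊕ S

/-- The lower or left endpoint. -/
def GridLine.tail {n T : ℕ} {S : Set (Fin (n - 1) × Fin T)} :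
    GridLine n T S → Fin n × Fin (T + 1)
  | .inl q => (q.1, q.2.castSucc)
  | .inr q => (leftCol q.1.1, q.1.2.castSucc)

/-- The upper or right endpoint. -/
def GridLine.head {n T : ℕ} {S : Set (Fin (n - 1) × Fin T)} :
    GridLine n T S → Fin n × Fin (T + 1)
  | .inl q => (q.1, q.2.succ)
  | .inr q => (rightCol q.1.1, q.1.2.castSucc)

/-- The grid with horizontal edges `S`, whose boundary is the top row. An oriented edge `(a, b)`
points up or to the right if `b` is `true`, down or to the left if `b` is `false`. -/
def gridGraph (n T : ℕ) (S : Set (Fin (n - 1) × Fin T)) :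
    BGraph (Fin n × Fin (T + 1)) (GridLine n T S × Bool) where
  src e := cond e.2 (GridLine.tail e.1) (GridLine.head e.1)
  tgt e := cond e.2 (GridLine.head e.1) (GridLine.tail e.1)
  rev e := (e.1, !e.2)
  rev_rev e := by simp
  rev_ne e h := by simpa using congrArg Prod.snd h
  src_rev e := by rcases e with ⟨e, _ | _⟩ <;> rfl
  tgt_rev e := by rcases e with ⟨e, _ | _⟩ <;> rfl
  boundary := {p | p.2 = Fin.last T}

variable {F : Type*} [Field F] {n T : ℕ}

/-- The positions in the first `T` rows where the horizontal weights `c` are nonzero. -/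
def horizontalSupport (T : ℕ) (c : ℕ → Fin (n - 1) → F) : Set (Fin (n - 1) × Fin T) :=
  {q | c q.2 q.1 ≠ 0}

/-- The network on the grid with vertical resistances `ρ` and horizontal weights `c`. -/
def gridNetwork (T : ℕ) (ρ : ℕ → Fin n → F) (c : ℕ → Fin (n - 1) → F) (hρ : ∀ t i, ρ t i ≠ 0) :
    Network F (Fin n × Fin (T + 1)) (GridLine n T (horizontalSupport T c) × Bool) where
  toBGraph := gridGraph n T (horizontalSupport T c)
  weight e := Sum.elim (fun q => (ρ q.2 q.1)⁻¹) (fun q => c q.1.2 q.1.1) e.1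
  weight_ne_zero e := by
    rcases e with ⟨q | q, b⟩
    · exact inv_ne_zero (hρ _ _)
    · exact q.2
  weight_rev e := rfl

/-- The identification of the columns with the vertices in the top row. -/
def topRow (T : ℕ) (ρ : ℕ → Fin n → F) (c : ℕ → Fin (n - 1) → F) (hρ : ∀ t i, ρ t i ≠ 0) :
    Fin n ≃ (gridNetwork T ρ c hρ).boundary where
  toFun i := ⟨(i, Fin.last T), rfl⟩
  invFun p := p.1.1
  left_inv _ := rfl
  right_inv p := Subtype.ext (Prod.ext rfl (Eq.symm p.2))

/-- The outgoing current of a potential with rows `U t` at the vertex `(i, s)`: it flows along the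
vertical edge below, if `s ≠ 0`, and along the vertical edge above and the horizontal edges, if `s`
is not the top row. -/
lemma laplacian_gridNetwork (ρ : ℕ → Fin n → F) (c : ℕ → Fin (n - 1) → F)
    (hρ : ∀ t i, ρ t i ≠ 0) [Fintype (horizontalSupport T c)] (U : ℕ → Fin n → F) (i : Fin n)
    (s : Fin (T + 1)) :
    (gridNetwork T ρ c hρ).laplacian (fun p => U p.2 p.1) (i, s) =
      (if (s : ℕ) = 0 then 0 else (ρ (s - 1) i)⁻¹ * (U s i - U (s - 1) i)) +
      if (s : ℕ) < T then (ρ s i)⁻¹ * (U s i - U (s + 1) i) + pathLaplacian (c s) (U s) i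
        else 0 := by
  classical
  have hcol : ∀ (P : ℕ → Prop) [DecidablePred P] (f : Fin n → ℕ → F),
      (∑ q : Fin n × Fin T, if q.1 = i ∧ P q.2 then f q.1 q.2 else 0) =
        ∑ t ∈ Finset.range T, if P t then f i t else 0 := by
    intro P _ f
    rw [Fintype.sum_prod_type_right,
      ← Fin.sum_univ_eq_sum_range (fun t => if P t then f i t else 0)]
    refine Finset.sum_congr rfl fun t _ => ?_
    simp [ite_and]
  have hdown := hcol (fun t => t + 1 = s) fun j t => (ρ t j)⁻¹ * (U (t + 1) j - U t j)
  have hup := hcol (fun t => t = s) fun j t => (ρ t j)⁻¹ * (U t j - U (t + 1) j)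
  have hhor : (∑ q : horizontalSupport T c,
      ((if leftCol q.1.1 = i ∧ (q.1.2 : ℕ) = s then c q.1.2 q.1.1 *
        (U q.1.2 (leftCol q.1.1) - U q.1.2 (rightCol q.1.1)) else 0) +
      if rightCol q.1.1 = i ∧ (q.1.2 : ℕ) = s then c q.1.2 q.1.1 *
        (U q.1.2 (rightCol q.1.1) - U q.1.2 (leftCol q.1.1)) else 0)) =
      ∑ t ∈ Finset.range T, if t = s then pathLaplacian (c t) (U t) i else 0 := by
    rw [← Fin.sum_univ_eq_sum_range (fun t => if t = s then pathLaplacian (c t) (U t) i else 0)]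
    -- positions of weight zero contribute nothing, so the sum may be taken over all of them
    rw [Fintype.sum_of_injective (Subtype.val : horizontalSupport T c → Fin (n - 1) × Fin T)
      Subtype.val_injective _ (fun q : Fin (n - 1) × Fin T =>
      ((if leftCol q.1 = i ∧ (q.2 : ℕ) = s then c q.2 q.1 *
        (U q.2 (leftCol q.1) - U q.2 (rightCol q.1)) else 0) +
      if rightCol q.1 = i ∧ (q.2 : ℕ) = s then c q.2 q.1 *
        (U q.2 (rightCol q.1) - U q.2 (leftCol q.1)) else 0)) _ fun _ => rfl]
    · rw [Fintype.sum_prod_type_right]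
      refine Finset.sum_congr rfl fun t _ => ?_
      by_cases h : (t : ℕ) = s <;> simp [h, pathLaplacian_apply]
    · intro q hq
      have : c q.2 q.1 = 0 := by
        by_contra h
        exact hq ⟨⟨q, h⟩, rfl⟩
      simp [this]
  have hlap : (gridNetwork T ρ c hρ).laplacian (fun p => U p.2 p.1) (i, s) =
      (∑ t ∈ Finset.range T, if t + 1 = s then (ρ t i)⁻¹ * (U (t + 1) i - U t i) else 0) +
      (∑ t ∈ Finset.range T, if t = s then (ρ t i)⁻¹ * (U t i - U (t + 1) i) else 0) +
      ∑ t ∈ Finset.range T, if t = s then pathLaplacian (c t) (U t) i else 0 := by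
    rw [← hdown, ← hup, ← hhor, Network.laplacian_apply, Fintype.sum_prod_type,
      Fintype.sum_sum_type, ← Finset.sum_add_distrib]
    congr 1
    · refine Finset.sum_congr rfl fun q _ => ?_
      simp [gridNetwork, gridGraph, GridLine.tail, GridLine.head, Prod.ext_iff, Fin.ext_iff]
    · refine Finset.sum_congr rfl fun q _ => ?_
      refine (Fintype.sum_bool _).trans ((add_comm _ _).trans ?_)
      simp [gridNetwork, gridGraph, GridLine.tail, GridLine.head, Prod.ext_iff, Fin.ext_iff]
  rw [hlap, add_assoc]
  congr 1
  · obtain ⟨s, hs⟩ := s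
    cases s with
    | zero => simp
    | succ s =>
      simp only [Nat.add_right_cancel_iff, Finset.sum_ite_eq', Finset.mem_range, Nat.succ_ne_zero,
        if_false, Nat.add_sub_cancel]
      exact if_pos (by omega)
  · by_cases h : (s : ℕ) < T <;> simp [h]

/-- The boundary behavior of a grid. A harmonic function is determined by its values in row `0`:
the potentials in row `t` and the currents from there to the row below arise from them through `t`
layers, and harmonicity in row `t` says that the pair passes through the next layer. -/
theorem labelledBehavior_gridNetwork (ρ : ℕ → Fin n → F) (c : ℕ → Fin (n - 1) → F)
    (hρ : ∀ t i, ρ t i ≠ 0) [Fintype (horizontalSupport T c)] :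
    (gridNetwork T ρ c hρ).labelledBehavior (topRow T ρ c hρ) =
      (Submodule.prod ⊤ ⊥).map (flow ρ c T) := by
  ext v
  rw [Network.mem_labelledBehavior, Submodule.mem_map]
  constructor
  · rintro ⟨u, hu, h1, h2⟩
    -- the rows of `u`, and the currents from each row to the row below
    let U : ℕ → Fin n → F := fun t i => u (i, ⟨min t T, by omega⟩)
    let J : ℕ → Fin n → F := fun t i =>
      if t = 0 then 0 else (ρ (t - 1) i)⁻¹ * (U t i - U (t - 1) i)
    have hU : u = fun p => U p.2 p.1 := by
      funext p
      refine congrArg u (Prod.ext rfl (Fin.ext ?_))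
      have := p.2.2
      simp only
      omega
    have hflow : ∀ t ≤ T, flow ρ c t (U 0, 0) = (U t, J t) := by
      intro t
      induction t with
      | zero => intro _; ext i <;> simp [flow, J]
      | succ t ih =>
        intro ht
        have hJ : ∀ i, J (t + 1) i = J t i + pathLaplacian (c t) (U t) i := by
          intro i
          have h0 := hu (i, ⟨t, by omega⟩) (by
            intro h
            have := congrArg Fin.val (show (⟨t, _⟩ : Fin (T + 1)) = Fin.last T from h)
            simp at this
            omega)
          rw [hU, laplacian_gridNetwork] at h0
          simp only [show t < T by omega, if_true] at h0
          simp only [J, Nat.add_sub_cancel, Nat.succ_ne_zero, if_false]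
          linear_combination -h0
        rw [flow, LinearMap.comp_apply, LinearMap.comp_apply, ih (by omega), attachEdges_apply,
          attachSpikes_apply]
        ext i
        · simp only [Pi.add_apply, Pi.mul_apply, ← hJ]
          simp [J, mul_inv_cancel_left₀ (hρ t i)]
        · simp [hJ]
    refine ⟨(U 0, 0), by simp, ?_⟩
    rw [hflow T le_rfl]
    refine Prod.ext ?_ ?_
    · rw [← h1, hU]
      rfl
    · rw [← h2]
      funext i
      have := laplacian_gridNetwork (T := T) ρ c hρ U i (Fin.last T)
      rw [hU]
      simp only [Fin.val_last, lt_irrefl, if_false, add_zero] at this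
      exact this.symm
  · rintro ⟨w, hw, rfl⟩
    have hw2 : w.2 = 0 := by simpa using (Submodule.mem_prod.1 hw).2
    have hs1 : ∀ t i, (flow ρ c (t + 1) w).2 i =
        (flow ρ c t w).2 i + pathLaplacian (c t) (flow ρ c t w).1 i := fun t i => rfl
    have hs2 : ∀ t i, (flow ρ c (t + 1) w).1 i =
        (flow ρ c t w).1 i + ρ t i * (flow ρ c (t + 1) w).2 i := fun t i => rfl
    have hcur : ∀ t i, (flow ρ c t w).2 i = if t = 0 then 0 else
        (ρ (t - 1) i)⁻¹ * ((flow ρ c t w).1 i - (flow ρ c (t - 1) w).1 i) := by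
      intro t i
      cases t with
      | zero => simp [flow, hw2]
      | succ t => simp [hs2 t i, inv_mul_cancel_left₀ (hρ t i)]
    refine ⟨fun p => (flow ρ c p.2 w).1 p.1, ?_, rfl, ?_⟩
    · rintro ⟨i, s⟩ hs
      have hsT : (s : ℕ) < T := by
        refine lt_of_le_of_ne (Nat.lt_succ_iff.1 s.2) fun h => hs ?_
        exact Fin.ext h
      rw [laplacian_gridNetwork ρ c hρ (fun t => (flow ρ c t w).1), ← hcur, if_pos hsT]
      have h1 := hcur (s + 1) i
      simp only [Nat.succ_ne_zero, if_false, Nat.add_sub_cancel] at h1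
      linear_combination h1 - hs1 s i
    · funext i
      refine (laplacian_gridNetwork ρ c hρ (fun t => (flow ρ c t w).1) i (Fin.last T)).trans ?_
      rw [← hcur]
      simp

end Grid

/-! ### Grids are layerable -/

section Layering

variable {n T : ℕ} {S : Set (Fin (n - 1) × Fin T)}

/-- The rank of an unoriented edge of the grid, which determines when the edge is removed: vertices
of row `t` have rank `2 t`, edges in row `t` have rank `2 t + 1`, and edges between the rows `t` and
`t + 1` have rank `2 t + 2`. -/
def GridLine.rank : GridLine n T S → ℕ
  | .inl q => 2 * q.2 + 2
  | .inr q => 2 * q.1.2 + 1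

lemma GridLine.rank_tail_le (a : GridLine n T S) : 2 * (a.tail.2 : ℕ) ≤ a.rank := by
  rcases a with q | q <;> simp [tail, rank]

lemma GridLine.rank_head_le (a : GridLine n T S) : 2 * (a.head.2 : ℕ) ≤ a.rank := by
  rcases a with q | q <;> simp [head, rank]; omega

/-- The filtration of the grid by rank. At stage `2 j` the rows above row `T - j` are gone, and row
`T - j` is the boundary; at stage `2 j + 1` the edges in row `T - j` are gone as well. -/
def gridStage (n T : ℕ) (S : Set (Fin (n - 1) × Fin T)) (k : ℕ) : BSubgraph (gridGraph n T S) where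
  verts := {p | 2 * (p.2 : ℕ) + k ≤ 2 * T + 1}
  edges := {e | e.1.rank + k ≤ 2 * T + 1}
  interior := {p | 2 * (p.2 : ℕ) + k + 1 ≤ 2 * T}
  interior_subset p hp := by
    simp only [Set.mem_ofPred_eq] at hp ⊢
    omega
  interior_disjoint p hp h := by
    have : (p.2 : ℕ) = T := congrArg Fin.val h
    simp only [Set.mem_ofPred_eq] at hp
    omega
  rev_mem e he := he
  src_mem e he := by
    have h1 := e.1.rank_tail_le
    have h2 := e.1.rank_head_le
    rcases e with ⟨e, _ | _⟩ <;> simp only [gridGraph, Set.mem_ofPred_eq, cond_true, cond_false]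
      at he h1 h2 ⊢ <;> omega

/-- The filtration by rank alternates between deleting the edges in the top row and contracting all
vertical edges that end in the top row. -/
theorem layerable_gridGraph (n T : ℕ) (S : Set (Fin (n - 1) × Fin T)) :
    (gridGraph n T S).Layerable := by
  refine ⟨gridStage n T S, ?_, ?_, ?_⟩
  · ext p
    · have := p.2.2
      simp [gridStage, BSubgraph.whole]
      omega
    · rcases p with ⟨q | q, b⟩
      · have := q.2.2
        simp [gridStage, BSubgraph.whole, GridLine.rank]
      · have := q.1.2.2
        simp [gridStage, BSubgraph.whole, GridLine.rank]
    · have := p.2.2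
      simp [gridStage, BSubgraph.whole, gridGraph, Fin.ext_iff]
      omega
  · intro k
    rcases Nat.even_or_odd' k with ⟨j, rfl | rfl⟩
    · left
      refine ⟨?_, ?_, ?_, ?_⟩
      · ext p; simp only [gridStage, Set.mem_ofPred_eq]; omega
      · ext p; simp only [gridStage, Set.mem_ofPred_eq]; omega
      · intro e he; simp only [gridStage, Set.mem_ofPred_eq] at he ⊢; omega
      · rintro ⟨q | q, b⟩ ⟨h1, h2⟩ <;>
          simp only [gridStage, Set.mem_ofPred_eq, GridLine.rank] at h1 h2
        · omega
        · cases b <;> simp [gridStage, BSubgraph.bdry, gridGraph, GridLine.tail, GridLine.head] <;>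
            omega
    · right
      by_cases hj : j < T
      swap
      · left
        have hedge : (gridStage n T S (2 * j + 1)).edges = ∅ := by
          ext e
          have : 1 ≤ e.1.rank := by rcases e.1 with q | q <;> simp [GridLine.rank]
          simp only [gridStage, Set.mem_ofPred_eq, Set.mem_empty_iff_false, iff_false]
          omega
        refine ⟨?_, ?_, ?_, ?_⟩
        · rw [hedge, Set.eq_empty_iff_forall_notMem]
          intro e he
          have h : e ∈ (gridStage n T S (2 * j + 1)).edges := by
            simp only [gridStage, Set.mem_ofPred_eq] at he ⊢; omega
          rw [hedge] at h
          exact h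
        · ext p; simp only [gridStage, Set.mem_ofPred_eq]; omega
        · intro p hp; simp only [gridStage, Set.mem_ofPred_eq] at hp ⊢; omega
        · rintro p ⟨h1, -⟩
          refine ⟨⟨h1, ?_⟩, ?_⟩
          · simp only [gridStage, Set.mem_ofPred_eq]; omega
          · simp [BSubgraph.degree, hedge]
      · right
        -- the vertical edges with rows `T - j - 1` and `T - j`, oriented downwards
        refine ⟨{e | ∃ i : Fin n, e = (.inl (i, ⟨T - j - 1, by omega⟩), false)}, ?_, ?_, ?_, ?_, ?_⟩
        · rintro _ ⟨i, rfl⟩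
          refine ⟨?_, ⟨?_, ?_⟩, ?_, ?_⟩
          · simp [gridStage, GridLine.rank]; omega
          · simp [gridStage, gridGraph, GridLine.head]; omega
          · simp [gridStage, gridGraph, GridLine.head]; omega
          · rw [BSubgraph.degree, Set.encard_eq_one]
            refine ⟨(.inl (i, ⟨T - j - 1, by omega⟩), true), ?_⟩
            ext ⟨q | q, b⟩ <;> cases b <;>
              simp [gridStage, gridGraph, GridLine.head, GridLine.tail, GridLine.rank,
                Prod.ext_iff, Fin.ext_iff] <;> omega
          · simp [gridStage, gridGraph, GridLine.tail]; omega
        · rintro _ ⟨i, rfl⟩ _ ⟨i', rfl⟩ h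
          have hi : i ≠ i' := by rintro rfl; exact h rfl
          simp [gridGraph, GridLine.head, GridLine.tail, hi]
        · ext ⟨q | q, b⟩ <;> cases b <;>
            simp [gridStage, gridGraph, GridLine.rank, Prod.ext_iff, Fin.ext_iff] <;> omega
        · ext ⟨i, s⟩
          simp [gridStage, gridGraph, GridLine.head, Prod.ext_iff, Fin.ext_iff]
          refine ⟨fun h => ⟨by omega, fun _ _ _ _ => by omega⟩, fun h => ?_⟩
          have := h.2 i ⟨T - j - 1, by omega⟩ rfl rfl
          simp only at this
          omega
        · ext ⟨i, s⟩
          simp [gridStage, gridGraph, GridLine.tail, Prod.ext_iff, Fin.ext_iff]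
          refine ⟨fun h => ⟨by omega, fun _ _ _ _ => by omega⟩, fun h => ?_⟩
          have := h.2 i ⟨T - j - 1, by omega⟩ rfl rfl
          simp only at this
          omega
  · rw [Set.eq_empty_iff_forall_notMem]
    intro p hp
    have := Set.mem_iInter.1 hp (2 * T + 2)
    simp only [gridStage, Set.mem_ofPred_eq] at this
    omega

end Layering

/-! ### Grids are circular planar -/

section Planarity

/-- The point of the closed unit disk with polar coordinates proportional to `x` and `y + 1`. It
maps the rectangle `[0, A] × [0, B]` injectively onto a sector of an annulus whose outer arc, on the
unit circle, is the image of the side `y = B`. -/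
noncomputable def polarPoint (A B x y : ℝ) : ℂ :=
  (((y + 1) / (B + 1) : ℝ) : ℂ) * Complex.exp ((x / (A + 1) : ℝ) * Complex.I)

variable {A B : ℝ}

lemma norm_polarPoint (hB : 0 ≤ B) {x y : ℝ} (hy : 0 ≤ y) :
    ‖polarPoint A B x y‖ = (y + 1) / (B + 1) := by
  rw [polarPoint, norm_mul, Complex.norm_exp_ofReal_mul_I, mul_one, Complex.norm_real,
    Real.norm_of_nonneg (by positivity)]

lemma polarPoint_inj (hA : 0 ≤ A) (hB : 0 ≤ B) {x y x' y' : ℝ} (hx : x ∈ Set.Icc 0 A)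
    (hx' : x' ∈ Set.Icc 0 A) (hy : 0 ≤ y) (hy' : 0 ≤ y')
    (h : polarPoint A B x y = polarPoint A B x' y') : x = x' ∧ y = y' := by
  have hyy : y = y' := by
    have := congrArg norm h
    rw [norm_polarPoint hB hy, norm_polarPoint hB hy', div_left_inj' (by positivity)] at this
    linarith
  subst hyy
  refine ⟨?_, rfl⟩
  have hne : (((y + 1) / (B + 1) : ℝ) : ℂ) ≠ 0 := by
    exact_mod_cast (by positivity : (y + 1) / (B + 1) ≠ 0)
  have h2 := congrArg Complex.re (mul_left_cancel₀ hne h)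
  rw [Complex.exp_ofReal_mul_I_re, Complex.exp_ofReal_mul_I_re] at h2
  have hrange : ∀ z ∈ Set.Icc 0 A, z / (A + 1) ∈ Set.Icc 0 Real.pi := by
    intro z hz
    refine ⟨div_nonneg hz.1 (by linarith), ?_⟩
    rw [div_le_iff₀ (by linarith)]
    nlinarith [Real.pi_gt_three, hz.2]
  have h3 := Real.injOn_cos (hrange x hx) (hrange x' hx') h2
  rwa [div_left_inj' (by positivity)] at h3

lemma hasDerivAt_polarPoint_line (x y a b s : ℝ) :
    HasDerivAt (fun t : ℝ => polarPoint A B (x + t * a) (y + t * b))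
      ((((b / (B + 1) : ℝ) : ℂ) + ((y + s * b + 1) / (B + 1) * (a / (A + 1)) : ℝ) * Complex.I) *
        Complex.exp (((x + s * a) / (A + 1) : ℝ) * Complex.I)) s := by
  have h1 : HasDerivAt (fun t : ℝ => (y + t * b + 1) / (B + 1)) (b / (B + 1)) s := by
    simpa using ((((hasDerivAt_id s).mul_const b).const_add y).add_const 1).div_const (B + 1)
  have h2 : HasDerivAt (fun t : ℝ => (x + t * a) / (A + 1)) (a / (A + 1)) s := by
    simpa using (((hasDerivAt_id s).mul_const a).const_add x).div_const (A + 1)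
  have h3 := h1.ofReal_comp.mul (h2.ofReal_comp.mul_const Complex.I).cexp
  refine HasDerivAt.congr_deriv h3 ?_
  push_cast
  ring

lemma contDiff_polarPoint_line (x y a b : ℝ) :
    ContDiff ℝ ∞ (fun t : ℝ => polarPoint A B (x + t * a) (y + t * b)) := by
  unfold polarPoint
  have h1 : ContDiff ℝ ∞ (fun t : ℝ => (y + t * b + 1) / (B + 1)) := by fun_prop
  have h2 : ContDiff ℝ ∞ (fun t : ℝ => (x + t * a) / (A + 1)) := by fun_prop
  exact (Complex.ofRealCLM.contDiff.comp h1).mul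
    ((Complex.ofRealCLM.contDiff.comp h2).mul contDiff_const).cexp

variable {V E : Type}

/-- A graph with a straight-line drawing in the rectangle `[0, A] × [0, B]` that has exactly the
boundary vertices on the side `y = B` is circular planar: `polarPoint` maps the rectangle
into the disk. -/
theorem circularPlanar_of_straightLineDrawing (G : BGraph V E) (x y : V → ℝ) (hA : 0 ≤ A)
    (hB : 0 ≤ B) (hx : ∀ v, x v ∈ Set.Icc 0 A) (hy : ∀ v, y v ∈ Set.Icc 0 B)
    (hbdry : ∀ v, y v = B ↔ v ∈ G.boundary)
    (hlow : ∀ e, y (G.src e) < B ∨ y (G.tgt e) < B)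
    (hinj : ∀ v v', x v = x v' → y v = y v' → v = v')
    (hloop : ∀ e, G.src e ≠ G.tgt e)
    (hvert : ∀ e, ∀ s ∈ Set.Ioo (0 : ℝ) 1, ∀ v,
      x (G.src e) + s * (x (G.tgt e) - x (G.src e)) = x v →
      y (G.src e) + s * (y (G.tgt e) - y (G.src e)) ≠ y v)
    (hcross : ∀ e e', ∀ s ∈ Set.Ioo (0 : ℝ) 1, ∀ t ∈ Set.Ioo (0 : ℝ) 1,
      x (G.src e) + s * (x (G.tgt e) - x (G.src e)) =
        x (G.src e') + t * (x (G.tgt e') - x (G.src e')) →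
      y (G.src e) + s * (y (G.tgt e) - y (G.src e)) =
        y (G.src e') + t * (y (G.tgt e') - y (G.src e')) →
      (e' = e ∧ t = s) ∨ (e' = G.rev e ∧ t = 1 - s))
    (hdir : ∀ e e', G.src e = G.src e' → ∀ c : ℝ, 0 < c →
      x (G.tgt e') - x (G.src e') = c * (x (G.tgt e) - x (G.src e)) →
      y (G.tgt e') - y (G.src e') = c * (y (G.tgt e) - y (G.src e)) → e = e') :
    G.CircularPlanar := by
  have hseg : ∀ {C a b s : ℝ}, a ∈ Set.Icc 0 C → b ∈ Set.Icc 0 C → s ∈ Set.Icc (0 : ℝ) 1 →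
      a + s * (b - a) ∈ Set.Icc 0 C := by
    intro C a b s ha hb hs
    have := (convex_Icc (0 : ℝ) C).add_smul_sub_mem ha hb hs
    simpa using this
  have hderiv : ∀ e, ∀ s ∈ Set.Icc (0 : ℝ) 1, derivWithin (fun t : ℝ => polarPoint A B
      (x (G.src e) + t * (x (G.tgt e) - x (G.src e)))
      (y (G.src e) + t * (y (G.tgt e) - y (G.src e)))) (Set.Icc 0 1) s = _ := fun e s hs =>
    (hasDerivAt_polarPoint_line _ _ _ _ s).hasDerivWithinAt.derivWithin
      (uniqueDiffOn_Icc zero_lt_one s hs)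
  have hA1 : A + 1 ≠ 0 := by positivity
  have hB1 : B + 1 ≠ 0 := by positivity
  refine ⟨{
    pt := fun v => polarPoint A B (x v) (y v)
    curve := fun e t => polarPoint A B (x (G.src e) + t * (x (G.tgt e) - x (G.src e)))
      (y (G.src e) + t * (y (G.tgt e) - y (G.src e)))
    curve_zero := fun e => by simp
    curve_one := fun e => by simp
    curve_rev := fun e t _ => by
      rw [G.src_rev, G.tgt_rev]
      congr 1 <;> ring
    norm_pt_le := fun v => by
      rw [norm_polarPoint hB (hy v).1, div_le_one (by positivity)]
      linarith [(hy v).2]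
    norm_pt_eq_one_iff := fun v => by
      rw [norm_polarPoint hB (hy v).1, div_eq_one_iff_eq hB1, ← hbdry]
      constructor <;> intro h <;> linarith
    norm_curve_lt := fun e t ht => by
      rw [norm_polarPoint hB (hseg (hy _) (hy _) ⟨ht.1.le, ht.2.le⟩).1, div_lt_one (by positivity)]
      rcases hlow e with h | h <;>
        nlinarith [ht.1, ht.2, (hy (G.src e)).2, (hy (G.tgt e)).2]
    pt_injective := fun v v' h => by
      obtain ⟨h1, h2⟩ := polarPoint_inj hA hB (hx v) (hx v') (hy v).1 (hy v').1 h
      exact hinj v v' h1 h2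
    curve_ne_pt := fun e t ht v h => by
      have ht' : t ∈ Set.Icc (0 : ℝ) 1 := ⟨ht.1.le, ht.2.le⟩
      obtain ⟨h1, h2⟩ := polarPoint_inj hA hB (hseg (hx _) (hx _) ht') (hx v)
        (hseg (hy _) (hy _) ht').1 (hy v).1 h
      exact hvert e t ht v h1 h2
    curve_injective := fun e e' s hs t ht h => by
      have hs' : s ∈ Set.Icc (0 : ℝ) 1 := ⟨hs.1.le, hs.2.le⟩
      have ht' : t ∈ Set.Icc (0 : ℝ) 1 := ⟨ht.1.le, ht.2.le⟩
      obtain ⟨h1, h2⟩ := polarPoint_inj hA hB (hseg (hx _) (hx _) hs') (hseg (hx _) (hx _) ht')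
        (hseg (hy _) (hy _) hs').1 (hseg (hy _) (hy _) ht').1 h
      exact hcross e e' s hs t ht h1 h2
    smooth := fun e => (contDiff_polarPoint_line _ _ _ _).contDiffOn
    immersion := fun e t ht => by
      rw [hderiv e t ht]
      refine mul_ne_zero (fun h => ?_) (Complex.exp_ne_zero _)
      have hre := congrArg Complex.re h
      have him := congrArg Complex.im h
      simp only [Complex.add_re, Complex.ofReal_re, Complex.re_ofReal_mul, Complex.I_re, mul_zero,
        add_zero, Complex.zero_re, Complex.add_im, Complex.ofReal_im, Complex.im_ofReal_mul,
        Complex.I_im, mul_one, zero_add, Complex.zero_im] at hre him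
      have hpos : 0 < (y (G.src e) + t * (y (G.tgt e) - y (G.src e)) + 1) / (B + 1) := by
        have := (hseg (hy (G.src e)) (hy (G.tgt e)) ht).1
        positivity
      rcases mul_eq_zero.1 him with h' | h'
      · exact hpos.ne' h'
      · rw [div_eq_zero_iff, or_iff_left hA1] at h'
        rw [div_eq_zero_iff, or_iff_left hB1] at hre
        exact hloop e (hinj _ _ (by linarith) (by linarith))
    directions := fun e e' hne hsrc c hc h => by
      have h0 : (0 : ℝ) ∈ Set.Icc (0 : ℝ) 1 := by simp
      rw [hderiv e 0 h0, hderiv e' 0 h0] at h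
      simp only [zero_mul, add_zero, ← hsrc, Complex.real_smul] at h
      rw [← mul_assoc] at h
      have h' := mul_right_cancel₀ (Complex.exp_ne_zero _) h
      have hre := congrArg Complex.re h'
      have him := congrArg Complex.im h'
      simp only [Complex.add_re, Complex.ofReal_re, Complex.re_ofReal_mul, Complex.I_re, mul_zero,
        add_zero, Complex.add_im, Complex.ofReal_im, Complex.im_ofReal_mul,
        Complex.I_im, mul_one, zero_add] at hre him
      have hpos : (y (G.src e) + 1) / (B + 1) ≠ 0 := by
        have := (hy (G.src e)).1
        positivity
      refine hne (hdir e e' hsrc c hc ?_ ?_)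
      · rw [← hsrc]
        rw [mul_left_comm] at him
        have := mul_left_cancel₀ hpos him
        field_simp at this
        linarith
      · rw [← hsrc]
        field_simp at hre
        linarith }⟩

lemma natCast_add_eq {i j : ℕ} {s t : ℝ} (hs : s ∈ Set.Ico (0 : ℝ) 1) (ht : t ∈ Set.Ico (0 : ℝ) 1)
    (h : (i : ℝ) + s = j + t) : i = j ∧ s = t := by
  have hij : i = j := by
    have h1 : (i : ℝ) < j + 1 := by linarith [hs.1, ht.2]
    have h2 : (j : ℝ) < i + 1 := by linarith [ht.1, hs.2]
    norm_cast at h1 h2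
    omega
  subst hij
  exact ⟨rfl, by linarith⟩

variable {n T : ℕ} {S : Set (Fin (n - 1) × Fin T)}

/-- Distinct edges of the grid, drawn with vertex `(i, t)` at the point `(i, t)`, have disjoint
interiors. -/
lemma gridLine_cross (a a' : GridLine n T S) {s t : ℝ} (hs : s ∈ Set.Ioo (0 : ℝ) 1)
    (ht : t ∈ Set.Ioo (0 : ℝ) 1)
    (hx : (a.tail.1 : ℝ) + s * ((a.head.1 : ℝ) - a.tail.1) =
      a'.tail.1 + t * ((a'.head.1 : ℝ) - a'.tail.1))
    (hy : (a.tail.2 : ℝ) + s * ((a.head.2 : ℝ) - a.tail.2) =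
      a'.tail.2 + t * ((a'.head.2 : ℝ) - a'.tail.2)) : a' = a ∧ t = s := by
  have hs' : s ∈ Set.Ico (0 : ℝ) 1 := ⟨hs.1.le, hs.2⟩
  have ht' : t ∈ Set.Ico (0 : ℝ) 1 := ⟨ht.1.le, ht.2⟩
  have h0 : (0 : ℝ) ∈ Set.Ico (0 : ℝ) 1 := by simp
  rcases a with q | q <;> rcases a' with q' | q' <;>
    simp only [GridLine.tail, GridLine.head, leftCol, rightCol, Fin.val_castSucc, Fin.val_succ,
      Nat.cast_add, Nat.cast_one, add_sub_cancel_left, sub_self, mul_one, mul_zero] at hx hy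
  · obtain ⟨h1, -⟩ := natCast_add_eq h0 h0 hx
    obtain ⟨h2, h3⟩ := natCast_add_eq hs' ht' hy
    exact ⟨congrArg Sum.inl (Prod.ext (Fin.ext h1.symm) (Fin.ext h2.symm)), h3.symm⟩
  · exact absurd (natCast_add_eq hs' h0 hy).2 hs.1.ne'
  · exact absurd (natCast_add_eq h0 ht' hy).2 ht.1.ne
  · obtain ⟨h1, h3⟩ := natCast_add_eq hs' ht' hx
    obtain ⟨h2, -⟩ := natCast_add_eq h0 h0 hy
    exact ⟨congrArg Sum.inr (Subtype.ext (Prod.ext (Fin.ext h1.symm) (Fin.ext h2.symm))), h3.symm⟩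

lemma gridLine_ne_vertex (a : GridLine n T S) {s : ℝ} (hs : s ∈ Set.Ioo (0 : ℝ) 1) (i t : ℕ)
    (hx : (a.tail.1 : ℝ) + s * ((a.head.1 : ℝ) - a.tail.1) = i)
    (hy : (a.tail.2 : ℝ) + s * ((a.head.2 : ℝ) - a.tail.2) = t) : False := by
  have hs' : s ∈ Set.Ico (0 : ℝ) 1 := ⟨hs.1.le, hs.2⟩
  have h0 : (0 : ℝ) ∈ Set.Ico (0 : ℝ) 1 := by simp
  rw [← add_zero (i : ℝ)] at hx
  rw [← add_zero (t : ℝ)] at hy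
  rcases a with q | q <;>
    simp only [GridLine.tail, GridLine.head, leftCol, rightCol, Fin.val_castSucc, Fin.val_succ,
      Nat.cast_add, Nat.cast_one, add_sub_cancel_left, mul_one] at hx hy
  · exact hs.1.ne' (natCast_add_eq hs' h0 hy).2
  · exact hs.1.ne' (natCast_add_eq hs' h0 hx).2

theorem circularPlanar_gridGraph (n T : ℕ) (S : Set (Fin (n - 1) × Fin T)) :
    (gridGraph n T S).CircularPlanar := by
  -- a point of an oriented edge, in terms of the parametrization of the unoriented edge
  have hpar : ∀ (e : GridLine n T S × Bool) (f : Fin n × Fin (T + 1) → ℝ) (s : ℝ),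
      f ((gridGraph n T S).src e) + s * (f ((gridGraph n T S).tgt e) - f ((gridGraph n T S).src e))
        = f e.1.tail + cond e.2 s (1 - s) * (f e.1.head - f e.1.tail) := by
    rintro ⟨a, _ | _⟩ f s <;> simp only [gridGraph, cond_true, cond_false]
    ring
  have hcond : ∀ (b : Bool) {s : ℝ}, s ∈ Set.Ioo (0 : ℝ) 1 →
      cond b s (1 - s) ∈ Set.Ioo (0 : ℝ) 1 := by
    rintro (_ | _) s ⟨h0, h1⟩
    · exact ⟨by simpa using h1, by simpa using h0⟩
    · exact ⟨h0, h1⟩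
  refine circularPlanar_of_straightLineDrawing (A := n) (B := T) _ (fun v => (v.1 : ℝ))
    (fun v => (v.2 : ℝ)) (by positivity) (by positivity) ?_ ?_ ?_ ?_ ?_ ?_ ?_ ?_ ?_
  · exact fun v => ⟨by positivity, by exact_mod_cast v.1.2.le⟩
  · exact fun v => ⟨by positivity, by exact_mod_cast Nat.lt_succ_iff.1 v.2.2⟩
  · intro v
    rw [Nat.cast_inj]
    exact ⟨fun h => Fin.ext h, fun h => congrArg Fin.val h⟩
  · rintro ⟨q | q, _ | _⟩ <;> simp [gridGraph, GridLine.tail, GridLine.head]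
  · intro v v' h1 h2
    exact Prod.ext (Fin.ext (Nat.cast_injective h1)) (Fin.ext (Nat.cast_injective h2))
  · rintro ⟨q | q, _ | _⟩ <;>
      simp [gridGraph, GridLine.tail, GridLine.head, leftCol, rightCol, Prod.ext_iff, Fin.ext_iff]
  · intro e s hs v h1 h2
    rw [hpar e (fun v => (v.1 : ℝ))] at h1
    rw [hpar e (fun v => (v.2 : ℝ))] at h2
    exact gridLine_ne_vertex e.1 (hcond e.2 hs) _ _ h1 h2
  · intro e e' s hs t ht h1 h2
    rw [hpar e (fun v => (v.1 : ℝ)), hpar e' (fun v => (v.1 : ℝ))] at h1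
    rw [hpar e (fun v => (v.2 : ℝ)), hpar e' (fun v => (v.2 : ℝ))] at h2
    obtain ⟨h3, h4⟩ := gridLine_cross e.1 e'.1 (hcond e.2 hs) (hcond e'.2 ht) h1 h2
    obtain ⟨a, b⟩ := e
    obtain ⟨a', b'⟩ := e'
    obtain rfl : a' = a := h3
    cases b <;> cases b' <;> simp only [cond_true, cond_false] at h4
    · exact Or.inl ⟨rfl, by linarith⟩
    · exact Or.inr ⟨rfl, h4⟩
    · exact Or.inr ⟨rfl, by linarith⟩
    · exact Or.inl ⟨rfl, h4⟩
  · rintro ⟨q | q, _ | _⟩ ⟨q' | q', _ | _⟩ h c hc h1 h2 <;>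
      simp [gridGraph, GridLine.tail, GridLine.head, leftCol, rightCol, Prod.ext_iff,
        Fin.ext_iff, Subtype.ext_iff] at h h1 h2 ⊢ <;> first | omega | linarith

end Planarity

/-! ### Lagrangian subspaces as boundary behaviors of grids -/

section Attainable

variable {F : Type*} [Field F] {n : ℕ}

lemma exists_ne_zero_ne (hF : Nat.card F ≠ 2) (a : F) : ∃ s, s ≠ 0 ∧ s ≠ a := by
  classical
  by_contra! h
  have huniv : (Set.univ : Set F) ⊆ {0, a} := fun s _ => by
    by_cases hs : s = 0
    · exact Or.inl hs
    · exact Or.inr (h s hs)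
  have hfin : Finite F := Set.finite_univ_iff.1 ((Set.toFinite {0, a}).subset huniv)
  have h1 := Finite.one_lt_card (α := F)
  have h2 := (Set.ncard_le_ncard huniv).trans (Set.ncard_insert_le 0 {a})
  rw [Set.ncard_univ, Set.ncard_singleton] at h2
  omega

/-- The subspaces obtained from that of `n` isolated boundary vertices by attaching layers. -/
def Attainable (Λ : Submodule F ((Fin n → F) × (Fin n → F))) : Prop :=
  ∃ (T : ℕ) (ρ : ℕ → Fin n → F) (c : ℕ → Fin (n - 1) → F), (∀ t i, ρ t i ≠ 0) ∧
    (Submodule.prod ⊤ ⊥).map (flow ρ c T) = Λ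

/-- The spikes in a layer may not have resistance zero. But every vector of resistances is the sum
of two vectors without zeros, so that two layers do what is wanted. -/
lemma Attainable.attach (hF : Nat.card F ≠ 2) {Λ : Submodule F ((Fin n → F) × (Fin n → F))}
    (hΛ : Attainable Λ) (r : Fin n → F) (c : Fin (n - 1) → F) :
    Attainable (Λ.map (attachSpikes r ∘ₗ attachEdges c)) := by
  obtain ⟨T, ρ, d, hρ, rfl⟩ := hΛ
  choose s hs0 hs using fun i => exists_ne_zero_ne hF (r i)
  refine ⟨T + 2, fun t => if t = T then s else if t = T + 1 then r - s else ρ t,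
    fun t => if t = T then c else if t = T + 1 then 0 else d t, ?_, ?_⟩
  · intro t i
    simp only
    split_ifs
    · exact hs0 i
    · exact sub_ne_zero.2 (hs i).symm
    · exact hρ t i
  · rw [← Submodule.map_comp]
    congr 1
    rw [flow, flow, flow_congr (ρ' := ρ) (c' := d) T]
    · simp only [if_true, Nat.succ_ne_self, if_false, attachEdges_zero, LinearMap.id_comp]
      rw [← LinearMap.comp_assoc, ← LinearMap.comp_assoc, attachSpikes_comp, sub_add_cancel]
    · intro t ht
      simp [show t ≠ T by omega, show t ≠ T + 1 by omega]
    · intro t ht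
      simp [show t ≠ T by omega, show t ≠ T + 1 by omega]

lemma Attainable.of_map_attachSpikes (hF : Nat.card F ≠ 2)
    {Λ : Submodule F ((Fin n → F) × (Fin n → F))} (r : Fin n → F)
    (hΛ : Attainable (Λ.map (attachSpikes r))) : Attainable Λ := by
  have := hΛ.attach hF (-r) 0
  rwa [attachEdges_zero, LinearMap.comp_id, ← Submodule.map_comp, attachSpikes_neg_comp,
    Submodule.map_id] at this

lemma Attainable.of_map_attachEdges (hF : Nat.card F ≠ 2)
    {Λ : Submodule F ((Fin n → F) × (Fin n → F))} (c : Fin (n - 1) → F)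
    (hΛ : Attainable (Λ.map (attachEdges c))) : Attainable Λ := by
  have := hΛ.attach hF 0 (-c)
  rwa [attachSpikes_zero, LinearMap.id_comp, ← Submodule.map_comp, attachEdges_neg_comp,
    Submodule.map_id] at this

lemma IsLagrangian.map {Λ : Submodule F ((Fin n → F) × (Fin n → F))} (hΛ : IsLagrangian Λ)
    {g g' : ((Fin n → F) × (Fin n → F)) →ₗ[F] ((Fin n → F) × (Fin n → F))}
    (hg : g' ∘ₗ g = LinearMap.id) (hg' : g ∘ₗ g' = LinearMap.id)
    (hsymp : ∀ v w, symplectic (g v) (g w) = symplectic v w) : IsLagrangian (Λ.map g) := by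
  have h1 : ∀ v, g' (g v) = v := LinearMap.congr_fun hg
  have h2 : ∀ v, g (g' v) = v := LinearMap.congr_fun hg'
  intro v
  have hv : v ∈ Λ.map g ↔ g' v ∈ Λ := by
    refine ⟨?_, fun h => ⟨_, h, h2 v⟩⟩
    rintro ⟨w, hw, rfl⟩
    rwa [h1]
  rw [hv, hΛ]
  constructor
  · rintro h _ ⟨w, hw, rfl⟩
    rw [← h2 v, hsymp]
    exact h w hw
  · intro h w hw
    rw [← hsymp, h2]
    exact h _ ⟨w, hw, rfl⟩

/-- Extension of a finite sequence by zero. -/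
def zeroExtend (f : Fin n → F) (k : ℕ) : F := if h : k < n then f ⟨k, h⟩ else 0

lemma zeroExtend_val (f : Fin n → F) (i : Fin n) : zeroExtend f i = f i := by
  simp [zeroExtend]

lemma zeroExtend_add (f g : Fin n → F) (k : ℕ) :
    zeroExtend (f + g) k = zeroExtend f k + zeroExtend g k := by
  unfold zeroExtend
  split_ifs <;> simp

lemma zeroExtend_smul (a : F) (f : Fin n → F) (k : ℕ) :
    zeroExtend (a • f) k = a * zeroExtend f k := by
  unfold zeroExtend
  split_ifs <;> simp

lemma zeroExtend_sub (f g : Fin n → F) (k : ℕ) :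
    zeroExtend (f - g) k = zeroExtend f k - zeroExtend g k := by
  unfold zeroExtend
  split_ifs <;> simp

lemma zeroExtend_single (i : Fin n) (a : F) (k : ℕ) :
    zeroExtend (Pi.single i a) k = if k = i then a else 0 := by
  unfold zeroExtend
  split_ifs with h1 h2 h2
  · subst h2; simp
  · rw [Pi.single_eq_of_ne]
    rintro rfl
    exact h2 rfl
  · omega
  · rfl

/-- Coordinates on boundary data modulo constant potentials: the entry `2 k` is the potential
difference between the vertices `k` and `0`, and the entry `2 k + 1` is the total current at
the vertices `0, …, k`. A spike at `k ≠ 0` changes only the entry `2 k`, and an edge between `k` and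
`k + 1` only the entry `2 k + 1`, by a multiple of the difference of the adjacent entries. -/
def chainCoord (v : (Fin n → F) × (Fin n → F)) (j : ℕ) : F :=
  if Even j then zeroExtend v.1 (j / 2) - zeroExtend v.1 0
  else ∑ i ∈ Finset.range (j / 2 + 1), zeroExtend v.2 i

lemma chainCoord_even (v : (Fin n → F) × (Fin n → F)) (k : ℕ) :
    chainCoord v (2 * k) = zeroExtend v.1 k - zeroExtend v.1 0 := by
  simp [chainCoord]

lemma chainCoord_odd (v : (Fin n → F) × (Fin n → F)) (k : ℕ) :
    chainCoord v (2 * k + 1) = ∑ i ∈ Finset.range (k + 1), zeroExtend v.2 i := by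
  have h : ¬ Even (2 * k + 1) := by simp
  have h' : (2 * k + 1) / 2 = k := by omega
  simp [chainCoord, h']

lemma chainCoord_zero (v : (Fin n → F) × (Fin n → F)) : chainCoord v 0 = 0 := by
  simpa using chainCoord_even v 0

lemma chainCoord_odd_sub (v : (Fin n → F) × (Fin n → F)) {k : ℕ} (hk : 0 < k) :
    chainCoord v (2 * k + 1) - chainCoord v (2 * k - 1) = zeroExtend v.2 k := by
  obtain ⟨k, rfl⟩ := Nat.exists_eq_succ_of_ne_zero hk.ne'
  rw [show 2 * k.succ - 1 = 2 * k + 1 by omega, chainCoord_odd, chainCoord_odd,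
    Finset.sum_range_succ]
  ring

lemma chainCoord_attachSpikes (v : (Fin n → F) × (Fin n → F)) (k : Fin n) (hk : 0 < (k : ℕ))
    (a : F) (j : ℕ) : chainCoord (attachSpikes (Pi.single k a) v) j = chainCoord v j +
      if j = 2 * k then a * (chainCoord v (2 * k + 1) - chainCoord v (2 * k - 1)) else 0 := by
  rw [chainCoord_odd_sub v hk, attachSpikes_apply,
    show Pi.single k a * v.2 = Pi.single k (a * v.2 k) by
      ext i; by_cases h : i = k
      · subst h; simp
      · simp [h]]
  rcases Nat.even_or_odd' j with ⟨l, rfl | rfl⟩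
  · simp only [chainCoord_even, zeroExtend_add, zeroExtend_single, hk.ne, if_false, add_zero]
    by_cases h : l = k
    · subst h
      simp [zeroExtend_val]
      ring
    · simp [h]
  · simp only [chainCoord_odd, show 2 * l + 1 ≠ 2 * (k : ℕ) by omega, if_false, add_zero]

lemma pathLaplacian_single (k : Fin (n - 1)) (a : F) (x : Fin n → F) :
    pathLaplacian (Pi.single k a) x = (a * (x (leftCol k) - x (rightCol k))) •
      (Pi.single (leftCol k) 1 - Pi.single (rightCol k) 1) := by
  rw [pathLaplacian_def, Finset.sum_eq_single k]
  · simp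
  · intro l _ hl
    simp [hl]
  · simp

lemma chainCoord_attachEdges (v : (Fin n → F) × (Fin n → F)) (k : Fin (n - 1)) (a : F) (j : ℕ) :
    chainCoord (attachEdges (Pi.single k a) v) j = chainCoord v j +
      if j = 2 * k + 1 then a * (chainCoord v (2 * k) - chainCoord v (2 * k + 2)) else 0 := by
  have hd : chainCoord v (2 * k) - chainCoord v (2 * k + 2) =
      v.1 (leftCol k) - v.1 (rightCol k) := by
    rw [show 2 * (k : ℕ) + 2 = 2 * (k + 1) by ring, chainCoord_even, chainCoord_even,
      ← zeroExtend_val v.1 (leftCol k), ← zeroExtend_val v.1 (rightCol k)]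
    simp [leftCol, rightCol]
  rw [hd, attachEdges_apply, pathLaplacian_single]
  rcases Nat.even_or_odd' j with ⟨l, rfl | rfl⟩
  · simp only [chainCoord_even, show 2 * l ≠ 2 * (k : ℕ) + 1 by omega, if_false, add_zero]
  · simp only [chainCoord_odd, zeroExtend_add, zeroExtend_smul, zeroExtend_sub, zeroExtend_single,
      Finset.sum_add_distrib, ← Finset.mul_sum, Finset.sum_sub_distrib, Finset.sum_ite_eq',
      Finset.mem_range]
    congr 1
    simp only [leftCol, rightCol]
    rcases lt_trichotomy l k with h | h | h
    · simp [show ¬ (k : ℕ) < l + 1 by omega, show ¬ (k : ℕ) + 1 < l + 1 by omega, h.ne]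
    · simp [h]
    · simp [show (k : ℕ) < l + 1 by omega, show (k : ℕ) + 1 < l + 1 by omega, h.ne']

lemma symplectic_single_left (j : Fin n) (w : (Fin n → F) × (Fin n → F)) :
    symplectic (Pi.single j 1, 0) w = w.2 j := by
  simp [symplectic]

lemma symplectic_const_left (w : (Fin n → F) × (Fin n → F)) :
    symplectic (fun _ => 1, 0) w = ∑ i, w.2 i := by
  simp [symplectic, dotProduct]

/-- If the vertices after `m` carry no current, the entry `2 m + 1` is the total current. -/
lemma chainCoord_last {m : ℕ} (hm : m < n) (v : (Fin n → F) × (Fin n → F))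
    (hv : ∀ j : Fin n, m + 1 ≤ (j : ℕ) → v.2 j = 0) :
    chainCoord v (2 * m + 1) = ∑ i, v.2 i := by
  have h : ∑ i, v.2 i = ∑ i ∈ Finset.range n, zeroExtend v.2 i := by
    rw [← Fin.sum_univ_eq_sum_range]
    exact Finset.sum_congr rfl fun i _ => (zeroExtend_val v.2 i).symm
  rw [chainCoord_odd, h]
  refine Finset.sum_subset (by simpa using hm) fun i hi hi' => ?_
  rw [Finset.mem_range] at hi hi'
  rw [zeroExtend, dif_pos hi]
  exact hv _ (by simpa using hi')

/-- Let the vertices after `m` be isolated in the Lagrangian `Λ`. If `Λ` contains a vector whose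
only nonzero coordinate is the potential difference between the vertices `m` and `0`, then vertex
`m` is isolated as well. -/
lemma single_mem_of_chainCoord {m : ℕ} (hm : m < n)
    {Λ : Submodule F ((Fin n → F) × (Fin n → F))} (hΛ : IsLagrangian Λ)
    (h1 : (fun _ => 1, 0) ∈ Λ) (hiso : ∀ j : Fin n, m + 1 ≤ (j : ℕ) → (Pi.single j 1, 0) ∈ Λ)
    {v : (Fin n → F) × (Fin n → F)} (hv : v ∈ Λ) (h0 : ∀ j < 2 * m, chainCoord v j = 0)
    (hne : chainCoord v (2 * m) ≠ 0) (hlast : chainCoord v (2 * m + 1) = 0) :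
    (Pi.single ⟨m, hm⟩ 1, 0) ∈ Λ := by
  have hcur : ∀ w ∈ Λ, ∀ j : Fin n, m + 1 ≤ (j : ℕ) → w.2 j = 0 := fun w hw j hj => by
    rw [← symplectic_single_left]
    exact (hΛ _).1 (hiso j hj) w hw
  rw [hΛ]
  intro w hw
  rw [symplectic_single_left]
  have hv2 : v.2 = 0 := by
    funext j
    by_cases hj : m + 1 ≤ (j : ℕ)
    · exact hcur v hv j hj
    have hodd : ∀ k ≤ m, chainCoord v (2 * k + 1) = 0 := by
      intro k hk
      rcases hk.lt_or_eq with h | rfl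
      · exact h0 _ (by omega)
      · exact hlast
    rw [← zeroExtend_val v.2 j, Pi.zero_apply]
    by_cases hj0 : (j : ℕ) = 0
    · have := hodd 0 (by omega)
      rw [chainCoord_odd] at this
      simpa [hj0] using this
    · rw [← chainCoord_odd_sub v (by omega), hodd j (by omega),
        show 2 * (j : ℕ) - 1 = 2 * (j - 1) + 1 by omega, hodd _ (by omega), sub_zero]
  have hω := (hΛ v).1 hv w hw
  have htot := (hΛ _).1 h1 w hw
  rw [symplectic_const_left] at htot
  rw [symplectic, hv2, zero_dotProduct, sub_zero] at hω
  -- subtract the constant potential `x 0` from `v`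
  have hsum : ∑ i, (v.1 i - zeroExtend v.1 0) * w.2 i = 0 := by
    simp only [sub_mul, Finset.sum_sub_distrib, ← Finset.mul_sum, htot, mul_zero, sub_zero]
    exact hω
  rw [Finset.sum_eq_single ⟨m, hm⟩] at hsum
  · refine (mul_eq_zero.1 hsum).resolve_left fun h => hne ?_
    rw [chainCoord_even, ← h, zeroExtend, dif_pos hm]
  · intro j _ hj
    by_cases hjm : m + 1 ≤ (j : ℕ)
    · rw [hcur w hw j hjm, mul_zero]
    · have : (j : ℕ) ≠ m := fun h => hj (Fin.ext h)
      rw [← zeroExtend_val v.1 j, ← chainCoord_even, h0 _ (by omega), zero_mul]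
  · simp

/-- A Lagrangian subspace that contains the constant potentials is attainable, by induction on the
number `m` of vertices that are not known to be isolated. For `m = n` nothing is assumed about
isolated vertices. -/
theorem attainable_of_isolated (hF : Nat.card F ≠ 2) (m : ℕ) :
    ∀ Λ : Submodule F ((Fin n → F) × (Fin n → F)), IsLagrangian Λ → (fun _ => 1, 0) ∈ Λ →
      (∀ j : Fin n, m ≤ (j : ℕ) → (Pi.single j 1, 0) ∈ Λ) → Attainable Λ := by
  induction m with
  | zero =>
    intro Λ hΛ _ hiso
    have hcur : ∀ w ∈ Λ, w.2 = 0 := fun w hw => by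
      funext j
      rw [← symplectic_single_left]
      exact (hΛ _).1 (hiso j (Nat.zero_le _)) w hw
    refine ⟨0, fun _ _ => 1, fun _ _ => 0, fun _ _ => one_ne_zero, ?_⟩
    rw [flow, Submodule.map_id]
    ext v
    simp only [Submodule.mem_prod, Submodule.mem_top, true_and, Submodule.mem_bot]
    refine ⟨fun hv => (hΛ v).2 fun w hw => ?_, hcur v⟩
    simp [symplectic, hv, hcur w hw]
  | succ m ih =>
    intro Λ hΛ h1 hiso
    by_cases hm : m < n
    swap
    · exact ih Λ hΛ h1 fun j hj => absurd j.2 (by omega)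
    have base' : ∀ Λ : Submodule F ((Fin n → F) × (Fin n → F)), IsLagrangian Λ →
        (fun _ => 1, 0) ∈ Λ → (∀ j : Fin n, m + 1 ≤ (j : ℕ) → (Pi.single j 1, 0) ∈ Λ) →
        (Pi.single ⟨m, hm⟩ 1, 0) ∈ Λ → Attainable Λ := by
      intro Λ hΛ h1 hiso h
      refine ih Λ hΛ h1 fun j hj => ?_
      rcases hj.eq_or_lt with h' | h'
      · rwa [show j = ⟨m, hm⟩ from Fin.ext h'.symm]
      · exact hiso j h'
    by_cases hmem : (Pi.single ⟨m, hm⟩ 1, 0) ∈ Λ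
    · exact base' Λ hΛ h1 hiso hmem
    obtain ⟨v, hv, hvm⟩ : ∃ v ∈ Λ, v.2 ⟨m, hm⟩ ≠ 0 := by
      rw [hΛ] at hmem
      push Not at hmem
      simpa only [symplectic_single_left] using hmem
    have hlast : chainCoord v (2 * m + 1) = 0 := by
      rw [chainCoord_last hm, ← symplectic_const_left]
      · exact (hΛ _).1 h1 v hv
      · intro j hj
        rw [← symplectic_single_left]
        exact (hΛ _).1 (hiso j hj) v hv
    refine good_of_exists_ne_zero (m := m) (good := fun p =>
      ∀ Λ : Submodule F ((Fin n → F) × (Fin n → F)), IsLagrangian Λ → (fun _ => 1, 0) ∈ Λ →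
        (∀ j : Fin n, m + 1 ≤ (j : ℕ) → (Pi.single j 1, 0) ∈ Λ) →
        ∀ v ∈ Λ, (∀ j ≤ 2 * m + 1, chainCoord v j = p j) → Attainable Λ)
      (exists_ne_zero_ne hF) ?_ ?_ (chainCoord v) (chainCoord_zero v) hlast ?_ Λ hΛ h1 hiso v hv
      fun _ _ => rfl
    · intro p h0 hne hlast Λ hΛ h1 hiso v hv hvp
      refine base' Λ hΛ h1 hiso (single_mem_of_chainCoord hm hΛ h1 hiso hv ?_ ?_ ?_)
      · intro j hj
        rw [hvp j (by omega), h0 j hj]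
      · rwa [hvp _ (by omega)]
      · rw [hvp _ le_rfl, hlast]
    · intro p j a hj1 hj2 hnb hgood Λ hΛ h1 hiso v hv hvp
      rcases Nat.even_or_odd' j with ⟨k, rfl | rfl⟩
      · have hd : p (2 * k + 1) - p (2 * k - 1) ≠ 0 := sub_ne_zero.2 hnb.symm
        have hkn : k < n := by omega
        let r : Fin n → F :=
          Pi.single ⟨k, hkn⟩ ((a - p (2 * k)) / (p (2 * k + 1) - p (2 * k - 1)))
        -- spikes do not affect vectors without current
        have hfix : ∀ x : Fin n → F, (x, 0) ∈ Λ → (x, 0) ∈ Λ.map (attachSpikes r) :=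
          fun x hx => ⟨(x, 0), hx, by simp [attachSpikes_apply]⟩
        refine Attainable.of_map_attachSpikes hF r (hgood _ (hΛ.map (attachSpikes_neg_comp r)
          (by rw [attachSpikes_comp, add_neg_cancel, attachSpikes_zero])
          (symplectic_attachSpikes r)) (hfix _ h1) (fun j hj => hfix _ (hiso j hj))
          (attachSpikes r v) ⟨v, hv, rfl⟩ fun i hi => ?_)
        rw [chainCoord_attachSpikes v _ (show 0 < k by omega), hvp i hi]
        simp only
        rw [hvp _ (by omega), hvp _ (by omega)]
        by_cases h : i = 2 * k
        · rw [if_pos h, h, Function.update_self, div_mul_cancel₀ _ hd, add_sub_cancel]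
        · rw [if_neg h, Function.update_of_ne h, add_zero]
      · have hd : p (2 * k) - p (2 * k + 2) ≠ 0 := sub_ne_zero.2 hnb
        have hkn : k < n - 1 := by omega
        let c : Fin (n - 1) → F :=
          Pi.single ⟨k, hkn⟩ ((a - p (2 * k + 1)) / (p (2 * k) - p (2 * k + 2)))
        -- the edge does not affect potentials that agree at its two ends
        have hfix : ∀ x : Fin n → F, x (leftCol ⟨k, hkn⟩) = x (rightCol ⟨k, hkn⟩) →
            (x, 0) ∈ Λ → (x, 0) ∈ Λ.map (attachEdges c) :=
          fun x hlr hx => ⟨(x, 0), hx, by simp [attachEdges_apply, c, pathLaplacian_single, hlr]⟩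
        refine Attainable.of_map_attachEdges hF c (hgood _ (hΛ.map (attachEdges_neg_comp c)
          (by simpa using attachEdges_neg_comp (-c))
          (symplectic_attachEdges c)) (hfix _ rfl h1) (fun j hj => hfix _ ?_ (hiso j hj))
          (attachEdges c v) ⟨v, hv, rfl⟩ fun i hi => ?_)
        · rw [Pi.single_eq_of_ne, Pi.single_eq_of_ne]
          · rintro rfl
            simp only [rightCol] at hj
            omega
          · rintro rfl
            simp only [leftCol] at hj
            omega
        rw [chainCoord_attachEdges v, hvp i hi]
        simp only
        rw [hvp _ (by omega), hvp _ (by omega)]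
        by_cases h : i = 2 * k + 1
        · rw [if_pos h, h, Function.update_self, div_mul_cancel₀ _ hd, add_sub_cancel]
        · rw [if_neg h, Function.update_of_ne h, add_zero]
    · -- vertex `m` carries the current `v.2 m ≠ 0`, which the entries `2 m ± 1` detect
      have hz := zeroExtend_val v.2 ⟨m, hm⟩
      have hm0 : 0 < m := by
        refine Nat.pos_of_ne_zero ?_
        rintro rfl
        apply hvm
        rw [← hz]
        rw [chainCoord_odd] at hlast
        simpa using hlast
      refine ⟨2 * m - 1, by omega, fun h => hvm ?_⟩
      rw [← hz]
      simp only
      rw [← chainCoord_odd_sub v hm0, hlast, h, sub_zero]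

end Attainable

end Electrical

theorem mainTheorem12 {F : Type*} [Field F] (hF : Nat.card F ≠ 2) (n : ℕ)
    (Λ : Submodule F ((Fin n → F) × (Fin n → F)))
    (hΛ : Λ ∈ Electrical.electricalGrassmannian F n) :
    ∃ (V E : Type) (_ : Fintype V) (_ : Fintype E) (N : Electrical.Network F V E)
      (lab : Fin n ≃ N.boundary),
      N.toBGraph.Layerable ∧ N.toBGraph.CircularPlanar ∧ N.labelledBehavior lab = Λ := by
  classical
  obtain ⟨V, E, _, _, N, lab, rfl⟩ := hΛ
  obtain ⟨T, ρ, c, hρ, h⟩ := Electrical.attainable_of_isolated hF n _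
    (N.isLagrangian_labelledBehavior lab) (N.const_mem_labelledBehavior lab)
    fun j hj => absurd j.2 (by omega)
  exact ⟨_, _, inferInstance, inferInstance, Electrical.gridNetwork T ρ c hρ,
    Electrical.topRow T ρ c hρ, Electrical.layerable_gridGraph n T _,
    Electrical.circularPlanar_gridGraph n T _,
    (Electrical.labelledBehavior_gridNetwork ρ c hρ).trans h⟩
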